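/- Let $k$ be an algebraically closed field of characteristic $0$, let $n\ge 0$, and let $r,\ p_{ij}$ $(1\le i<j\le n)$ be nonzero elements of $k$ with $r\neq 1$. Put $\kappa^i_j=p_{ij}$ for $i<j$, $\kappa^i_i=r$, $\kappa^i_j=r/p_{ji}$ for $i>j$, and let $R_Q(v_i\otimes v_j)=\sum_{c,d}R_{ij}^{cd}\,v_c\otimes v_d$, where $R_{ij}^{cd}=\kappa^i_j$ if $i=d,\ j=c$; $R_{ij}^{cd}=r-1$ if $i=c,\ j=d,\ i>j$; and $R_{ij}^{cd}=0$ otherwise. Let $A=A(R_Q)$ be the bialgebra generated by $T_i^j$ $(1\le i,j\le n)$ with relations $\sum_{a,b}R_{ij}^{ab}T_a^cT_b^d=\sum_{a,b}R_{ab}^{cd}T_i^aT_j^b$ and with $\Delta(T_i^j)=\sum_m T_i^m\otimes T_m^j$, $\varepsilon(T_i^j)=\delta_{ij}$. Let $\langle\cdot|\cdot\rangle_R$ be its braiding: the bilinear form with $\langle T_i^l|T_j^c\rangle_R=R_{ij}^{cl}$, $\langle aa'|b\rangle_R=\sum\langle a'|b_1\rangle_R\langle a|b_2\rangle_R$, $\langle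 a|bb'\rangle_R=\sum\langle a_1|b\rangle_R\langle a_2|b'\rangle_R$, $\langle 1|b\rangle_R=\varepsilon(b)$ and $\langle a|1\rangle_R=\varepsilon(a)$. For a bialgebra $H$ let $H^0$ be its finite dual (the functionals vanishing on a two-sided ideal of finite codimension), with the bialgebra structure dual to that of $H$, and let $H^{\mathrm{cop}}$ be $H$ with the opposite comultiplication. For $a,b\in A$ let $\lambda^+(a)=\langle a|-\rangle_R$ and $\rho^+(b)=\langle -|b\rangle_R$; these are elements of $A^0$. In $A^0$ let $K_i,L_i$ be the invertible group-like elements (algebra maps $A\to k$) with $K_i(T_j^l)=\delta_{jl}\kappa^i_j$ and $L_i(T_j^l)=\delta_{jl}(\kappa^j_i)^{-1}$, and for $1\le i<n$ let $E_{i+1}^i,F_i^{i+1}$ be the skew-primitive elements with $E_{i+1}^i(T_a^b)=\delta_{a,i}\delta_{b,i+1}$, $F_i^{i+1}(T_a^b)=\delta_{a,i+1}\delta_{b,i}$, $\Delta(E_{i+1}^i)=K_{i+1}\otimes E_{i+1}^i+E_{i+1}^i\otimes K_i$ and $\Delta(F_i^{i+1})=L_i\otimes F_i^{i+1}+F_i^{i+1}\otimes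 L_{i+1}$. Let $B^l$ be the subalgebra of $A^0$ generated by all $K_i^{\pm1},E_{i+1}^i$, and $B^r$ the one generated by all $L_i^{\pm1},F_i^{i+1}$; both are sub-bialgebras of $A^0$. **Lemma.** $B^l$, $B^r$ and $(B^l)^{0\,\mathrm{cop}}$ are Hopf algebras (they have antipodes), $\lambda^+(A)\subseteq B^l$, $\rho^+(A)\subseteq B^r$, and there is an injective Hopf algebra map $$\theta: B^r\hookrightarrow (B^l)^{0\,\mathrm{cop}}$$ (a map of algebras and of coalgebras that commutes with the antipodes) such that $\theta(\rho^+(b))(\lambda^+(a))=\langle a|b\rangle_R$ for all $a,b\in A$. -/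

import Mathlib

noncomputable section

namespace QHopf

open scoped TensorProduct

/-! ## Tensor products over a field -/

section Tensor

variable {k : Type*} [Field k]

/-- Elements of `D ⊗ N` are separated by a separating family of functionals on `D`. -/
theorem tensor_ext_left {D N X : Type*} [AddCommGroup D] [Module k D] [AddCommGroup N] [Module k N]
    (ev : X → D →ₗ[k] k) (hev : ∀ d, (∀ x, ev x d = 0) → d = 0) (s t : D ⊗[k] N)
    (h : ∀ x, TensorProduct.lid k N ((ev x).rTensor N s) =
      TensorProduct.lid k N ((ev x).rTensor N t)) : s = t := by
  classical
  let b := Module.Basis.ofVectorSpace k N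
  apply (TensorProduct.equivFinsuppOfBasisRight b (M := D)).injective
  ext i
  rw [← sub_eq_zero]
  refine hev _ fun x => ?_
  have key : ∀ u : D ⊗[k] N, ev x (TensorProduct.equivFinsuppOfBasisRight b u i) =
      b.repr (TensorProduct.lid k N ((ev x).rTensor N u)) i := by
    intro u
    induction u with
    | zero => simp
    | tmul d m =>
      simp [mul_comm]
    | add u v hu hv => simp only [map_add, Finsupp.add_apply, hu, hv]
  rw [map_sub, key, key, h x, sub_self]

end Tensor

/-! ## The finite dual of a bialgebra -/

section FiniteDual

variable (k : Type*) [Field k] (H : Type*) [Ring H] [Bialgebra k H]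

open Coalgebra WithConv

/-- `f` vanishes on a two-sided ideal of finite codimension. -/
def VanishesOnCofiniteIdeal (f : H →ₗ[k] k) : Prop :=
  ∃ I : Ideal H, I.IsTwoSided ∧ Module.Finite k (H ⧸ I) ∧ ∀ x ∈ I, f x = 0

variable {k H}

theorem VanishesOnCofiniteIdeal.of_factor {F : Type*} [Ring F] [Algebra k F] [Module.Finite k F]
    (φ : H →ₐ[k] F) (g : F →ₗ[k] k) {f : H →ₗ[k] k} (hf : ∀ x, f x = g (φ x)) :
    VanishesOnCofiniteIdeal k H f := by
  refine ⟨RingHom.ker φ, inferInstance, ?_, fun x hx => ?_⟩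
  · have e := Submodule.Quotient.restrictScalarsEquiv k (RingHom.ker φ)
    have h1 : (Submodule.restrictScalars k (RingHom.ker φ)) = LinearMap.ker φ.toLinearMap := by
      ext x; rfl
    rw [h1] at e
    have e2 := φ.toLinearMap.quotKerEquivRange
    exact Module.Finite.equiv (e2.symm.trans e)
  · rw [RingHom.mem_ker] at hx
    rw [hf, hx, map_zero]

theorem VanishesOnCofiniteIdeal.exists_factor {f : H →ₗ[k] k}
    (hf : VanishesOnCofiniteIdeal k H f) :
    ∃ (I : Ideal H) (_ : I.IsTwoSided) (_ : Module.Finite k (H ⧸ I)) (g : (H ⧸ I) →ₗ[k] k),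
      ∀ x, f x = g (Ideal.Quotient.mkₐ k I x) := by
  obtain ⟨I, h2, hfin, h0⟩ := hf
  refine ⟨I, h2, hfin, ((I.restrictScalars k).liftQ f ?_) ∘ₗ
    (Submodule.Quotient.restrictScalarsEquiv k I).symm.toLinearMap, fun x => ?_⟩
  · intro x hx
    exact h0 x hx
  · rfl

variable (k H)

/-- The finite dual `H⁰`: the functionals that vanish on a two-sided ideal of finite codimension,
a subalgebra of the convolution algebra `H*`. -/
def finiteDualSubalgebra : Subalgebra k (WithConv (H →ₗ[k] k)) where
  carrier := {f | VanishesOnCofiniteIdeal k H f.ofConv}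
  mul_mem' := by
    intro f g hf hg
    obtain ⟨I, _, _, u, hu⟩ := VanishesOnCofiniteIdeal.exists_factor hf
    obtain ⟨J, _, _, v, hv⟩ := VanishesOnCofiniteIdeal.exists_factor hg
    refine VanishesOnCofiniteIdeal.of_factor (F := (H ⧸ I) ⊗[k] (H ⧸ J))
      ((Algebra.TensorProduct.map (Ideal.Quotient.mkₐ k I) (Ideal.Quotient.mkₐ k J)).comp
        (Bialgebra.comulAlgHom k H))
      (LinearMap.mul' k k ∘ₗ TensorProduct.map u v) fun x => ?_
    have h1 : f.ofConv = u ∘ₗ (Ideal.Quotient.mkₐ k I).toLinearMap := LinearMap.ext hu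
    have h2 : g.ofConv = v ∘ₗ (Ideal.Quotient.mkₐ k J).toLinearMap := LinearMap.ext hv
    rw [LinearMap.convMul_apply, h1, h2, TensorProduct.map_comp]
    rfl
  add_mem' := by
    intro f g hf hg
    obtain ⟨I, _, _, u, hu⟩ := VanishesOnCofiniteIdeal.exists_factor hf
    obtain ⟨J, _, _, v, hv⟩ := VanishesOnCofiniteIdeal.exists_factor hg
    refine VanishesOnCofiniteIdeal.of_factor (F := (H ⧸ I) × (H ⧸ J))
      ((Ideal.Quotient.mkₐ k I).prod (Ideal.Quotient.mkₐ k J))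
      (u ∘ₗ LinearMap.fst k _ _ + v ∘ₗ LinearMap.snd k _ _) fun x => ?_
    simp [hu, hv]
  algebraMap_mem' := by
    intro c
    refine VanishesOnCofiniteIdeal.of_factor (F := k) (Bialgebra.counitAlgHom k H)
      (c • LinearMap.id) fun x => ?_
    simp

/-- The finite dual `H⁰` of `H`, with the convolution product. -/
def FiniteDual : Type _ := finiteDualSubalgebra k H

instance : Ring (FiniteDual k H) := inferInstanceAs (Ring (finiteDualSubalgebra k H))

instance : Algebra k (FiniteDual k H) :=
  inferInstanceAs (Algebra k (finiteDualSubalgebra k H))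

variable {k H}

instance : FunLike (FiniteDual k H) H k where
  coe f := f.1.ofConv
  coe_injective _ _ h := Subtype.ext (WithConv.ext (DFunLike.coe_injective h))

instance : LinearMapClass (FiniteDual k H) k H k where
  map_add f := f.1.ofConv.map_add
  map_smulₛₗ f := f.1.ofConv.map_smul

/-- A functional that vanishes on a cofinite ideal, as an element of the finite dual. -/
def FiniteDual.mk (f : H →ₗ[k] k) (hf : VanishesOnCofiniteIdeal k H f) : FiniteDual k H :=
  ⟨toConv f, hf⟩

/-- The underlying functional. -/
def FiniteDual.toDual (f : FiniteDual k H) : H →ₗ[k] k := f.1.ofConv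

@[simp] theorem FiniteDual.mk_apply (f : H →ₗ[k] k) (hf : VanishesOnCofiniteIdeal k H f) (x : H) :
    FiniteDual.mk f hf x = f x := rfl

/-- Evaluation of elements of the finite dual at `x`. -/
def FiniteDual.ev (x : H) : FiniteDual k H →ₗ[k] k where
  toFun f := f x
  map_add' _ _ := rfl
  map_smul' _ _ := rfl

@[simp] theorem FiniteDual.add_apply (f g : FiniteDual k H) (x : H) : (f + g) x = f x + g x := rfl

@[simp] theorem FiniteDual.smul_apply (c : k) (f : FiniteDual k H) (x : H) :
    (c • f) x = c * f x := rfl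

theorem FiniteDual.ev_apply (x : H) (f : FiniteDual k H) : FiniteDual.ev x f = f x := rfl

@[ext] theorem FiniteDual.ext {f g : FiniteDual k H} (h : ∀ x, f x = g x) : f = g :=
  DFunLike.ext _ _ h

theorem FiniteDual.ev_separates (f : FiniteDual k H)
    (h : ∀ x : H, FiniteDual.ev x f = 0) : f = 0 :=
  FiniteDual.ext h

theorem FiniteDual.mul_apply (f g : FiniteDual k H) (x : H) :
    (f * g) x = LinearMap.mul' k k (TensorProduct.map f.toDual g.toDual (comul x)) := rfl

theorem FiniteDual.one_apply (x : H) : (1 : FiniteDual k H) x = counit (R := k) x := rfl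

/-- The pairing of `t = ∑ f ⊗ g` with `x ⊗ y`, that is `∑ f(x) g(y)`. -/
def FiniteDual.ev₂ (x y : H) : FiniteDual k H ⊗[k] FiniteDual k H →ₗ[k] k :=
  LinearMap.mul' k k ∘ₗ TensorProduct.map (FiniteDual.ev x) (FiniteDual.ev y)

@[simp] theorem FiniteDual.ev₂_tmul (x y : H) (f g : FiniteDual k H) :
    FiniteDual.ev₂ x y (f ⊗ₜ g) = f x * g y := rfl

theorem FiniteDual.ev_lid (x y : H) (t : FiniteDual k H ⊗[k] FiniteDual k H) :
    FiniteDual.ev y (TensorProduct.lid k _ ((FiniteDual.ev x).rTensor _ t)) =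
      FiniteDual.ev₂ x y t := by
  induction t with
  | zero => simp
  | tmul f g => simp [FiniteDual.ev_apply]
  | add u v hu hv => simp only [map_add, hu, hv]

theorem FiniteDual.tensor_ext {s t : FiniteDual k H ⊗[k] FiniteDual k H}
    (h : ∀ x y, FiniteDual.ev₂ x y s = FiniteDual.ev₂ x y t) : s = t := by
  refine tensor_ext_left (FiniteDual.ev (k := k) (H := H)) (FiniteDual.ev_separates (k := k) (H := H)) _ _ fun x => ?_
  refine FiniteDual.ext fun y => ?_
  exact (FiniteDual.ev_lid x y s).trans ((h x y).trans (FiniteDual.ev_lid x y t).symm)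

theorem FiniteDual.exists_comul (f : FiniteDual k H) :
    ∃ t : FiniteDual k H ⊗[k] FiniteDual k H, ∀ x y, FiniteDual.ev₂ x y t = f (x * y) := by
  obtain ⟨I, _, _, g, hg⟩ := VanishesOnCofiniteIdeal.exists_factor f.2
  let π := Ideal.Quotient.mkₐ k I
  let b := Module.finBasis k (H ⧸ I)
  let u (i) : FiniteDual k H := .mk (b.coord i ∘ₗ π.toLinearMap)
    (VanishesOnCofiniteIdeal.of_factor π (b.coord i) fun _ => rfl)
  let v (i) : FiniteDual k H := .mk ((g ∘ₗ LinearMap.mulLeft k (b i)) ∘ₗ π.toLinearMap)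
    (VanishesOnCofiniteIdeal.of_factor π (g ∘ₗ LinearMap.mulLeft k (b i)) fun _ => rfl)
  refine ⟨∑ i, u i ⊗ₜ v i, fun x y => ?_⟩
  have h1 : f (x * y) = g (π x * π y) := by
    have h2 : f (x * y) = g (π (x * y)) := hg (x * y)
    rw [h2, map_mul]
  rw [h1, map_sum]
  conv_rhs => rw [← b.sum_repr (π x)]
  rw [Finset.sum_mul, map_sum]
  refine Finset.sum_congr rfl fun i _ => ?_
  rw [FiniteDual.ev₂_tmul, smul_mul_assoc, map_smul]
  rfl

/-- The comultiplication of the finite dual, the transpose of the multiplication of `H`. -/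
def FiniteDual.comulMap : FiniteDual k H →ₗ[k] FiniteDual k H ⊗[k] FiniteDual k H where
  toFun f := (FiniteDual.exists_comul f).choose
  map_add' f g := FiniteDual.tensor_ext fun x y => by
    rw [map_add, (FiniteDual.exists_comul f).choose_spec, (FiniteDual.exists_comul g).choose_spec,
      (FiniteDual.exists_comul (f + g)).choose_spec]
    rfl
  map_smul' c f := FiniteDual.tensor_ext fun x y => by
    rw [map_smul, (FiniteDual.exists_comul f).choose_spec,
      (FiniteDual.exists_comul (c • f)).choose_spec]
    rfl

theorem FiniteDual.ev₂_comulMap (f : FiniteDual k H) (x y : H) :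
    FiniteDual.ev₂ x y (FiniteDual.comulMap f) = f (x * y) :=
  (FiniteDual.exists_comul f).choose_spec x y

theorem FiniteDual.lid_comulMap (f : FiniteDual k H) (x y : H) :
    (TensorProduct.lid k _ ((FiniteDual.ev x).rTensor _ (FiniteDual.comulMap f))) y =
      f (x * y) := by
  rw [← FiniteDual.ev₂_comulMap, ← FiniteDual.ev_lid]
  rfl

instance : Coalgebra k (FiniteDual k H) where
  comul := FiniteDual.comulMap
  counit := FiniteDual.ev 1
  coassoc := by
    refine LinearMap.ext fun f => ?_
    refine tensor_ext_left (FiniteDual.ev (k := k) (H := H)) (FiniteDual.ev_separates (k := k) (H := H)) _ _ fun x => ?_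
    refine FiniteDual.tensor_ext fun y z => ?_
    have h1 : ∀ t : FiniteDual k H ⊗[k] FiniteDual k H,
        FiniteDual.ev₂ y z (TensorProduct.lid k _ ((FiniteDual.ev x).rTensor _
          (TensorProduct.assoc k _ _ _ (FiniteDual.comulMap.rTensor (FiniteDual k H) t)))) =
        FiniteDual.ev₂ (x * y) z t := by
      intro t
      induction t with
      | zero => simp
      | add u v hu hv => simp only [map_add, hu, hv]
      | tmul f g =>
        rw [LinearMap.rTensor_tmul, FiniteDual.ev₂_tmul, ← FiniteDual.ev₂_comulMap]
        induction FiniteDual.comulMap f with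
        | zero => simp
        | add u v hu hv => simp only [map_add, TensorProduct.add_tmul, hu, hv, add_mul]
        | tmul a b =>
          simp only [TensorProduct.assoc_tmul, LinearMap.rTensor_tmul, TensorProduct.lid_tmul,
            map_smul, FiniteDual.ev₂_tmul, FiniteDual.ev_apply, smul_eq_mul, mul_assoc]
    have h2 : ∀ t : FiniteDual k H ⊗[k] FiniteDual k H,
        FiniteDual.ev₂ y z (TensorProduct.lid k _ ((FiniteDual.ev x).rTensor _
          (FiniteDual.comulMap.lTensor (FiniteDual k H) t))) =
        FiniteDual.ev₂ x (y * z) t := by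
      intro t
      induction t with
      | zero => simp
      | add u v hu hv => simp only [map_add, hu, hv]
      | tmul f g =>
        simp only [LinearMap.lTensor_tmul, LinearMap.rTensor_tmul, TensorProduct.lid_tmul,
            map_smul, FiniteDual.ev₂_comulMap, FiniteDual.ev₂_tmul, FiniteDual.ev_apply,
            smul_eq_mul]
    rw [LinearMap.comp_apply, LinearMap.comp_apply, LinearMap.comp_apply]
    refine (h1 _).trans (Eq.trans ?_ (h2 _).symm)
    rw [FiniteDual.ev₂_comulMap, FiniteDual.ev₂_comulMap, mul_assoc]
  rTensor_counit_comp_comul := by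
    refine LinearMap.ext fun f => (TensorProduct.lid k _).injective ?_
    refine FiniteDual.ext fun y => ?_
    refine (FiniteDual.lid_comulMap f 1 y).trans ?_
    rw [one_mul, TensorProduct.mk_apply, TensorProduct.lid_tmul, one_smul]
  lTensor_counit_comp_comul := by
    refine LinearMap.ext fun f => (TensorProduct.rid k _).injective ?_
    refine FiniteDual.ext fun y => ?_
    have h : ∀ t : FiniteDual k H ⊗[k] FiniteDual k H,
        FiniteDual.ev y (TensorProduct.rid k _ ((FiniteDual.ev 1).lTensor _ t)) =
          FiniteDual.ev₂ y 1 t := by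
      intro t
      induction t with
      | zero => simp
      | add u v hu hv => simp only [map_add, hu, hv]
      | tmul f g => simp [FiniteDual.ev_apply, mul_comm]
    refine (h _).trans ?_
    rw [FiniteDual.ev₂_comulMap, mul_one, LinearMap.flip_apply, TensorProduct.mk_apply,
      TensorProduct.rid_tmul, one_smul]

theorem FiniteDual.counit_apply (f : FiniteDual k H) : counit (R := k) f = f 1 := rfl

theorem FiniteDual.ev₂_comul (f : FiniteDual k H) (x y : H) :
    FiniteDual.ev₂ x y (comul f) = f (x * y) := FiniteDual.ev₂_comulMap f x y

/-- Pairing `s = ∑ f ⊗ g` with a tensor. -/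
theorem FiniteDual.ev₂_mul (s t : FiniteDual k H ⊗[k] FiniteDual k H) (x y : H) :
    FiniteDual.ev₂ x y (s * t) =
      ∑ i ∈ (ℛ k x).index, ∑ j ∈ (ℛ k y).index,
        FiniteDual.ev₂ ((ℛ k x).left i) ((ℛ k y).left j) s *
          FiniteDual.ev₂ ((ℛ k x).right i) ((ℛ k y).right j) t := by
  induction s with
  | zero => simp
  | add u v hu hv => simp only [add_mul, map_add, hu, hv, Finset.sum_add_distrib]
  | tmul f g =>
    induction t with
    | zero => simp
    | add u v hu hv => simp only [mul_add, map_add, hu, hv, Finset.sum_add_distrib]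
    | tmul f' g' =>
      have h1 : (f * f') x = ∑ i ∈ (ℛ k x).index, f ((ℛ k x).left i) * f' ((ℛ k x).right i) :=
        (ℛ k x).convMul_apply f.1 f'.1
      have h2 : (g * g') y = ∑ i ∈ (ℛ k y).index, g ((ℛ k y).left i) * g' ((ℛ k y).right i) :=
        (ℛ k y).convMul_apply g.1 g'.1
      rw [Algebra.TensorProduct.tmul_mul_tmul, FiniteDual.ev₂_tmul, h1, h2, Finset.sum_mul_sum]
      refine Finset.sum_congr rfl fun i _ => Finset.sum_congr rfl fun j _ => ?_
      rw [FiniteDual.ev₂_tmul, FiniteDual.ev₂_tmul]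
      ring

instance : Bialgebra k (FiniteDual k H) :=
  Bialgebra.mk' k (FiniteDual k H)
    (by rw [FiniteDual.counit_apply, FiniteDual.one_apply, Bialgebra.counit_one])
    (by
      intro f g
      rw [FiniteDual.counit_apply, FiniteDual.mul_apply, Bialgebra.comul_one]
      rfl)
    (by
      refine FiniteDual.tensor_ext fun x y => ?_
      rw [FiniteDual.ev₂_comul, FiniteDual.one_apply, Bialgebra.counit_mul]
      rfl)
    (by
      intro f g
      refine FiniteDual.tensor_ext fun x y => ?_
      rw [FiniteDual.ev₂_comul, FiniteDual.ev₂_mul, FiniteDual.mul_apply, Bialgebra.comul_mul]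
      conv_lhs => rw [← (ℛ k x).eq, ← (ℛ k y).eq]
      rw [Finset.sum_mul_sum, map_sum, map_sum]
      refine Finset.sum_congr rfl fun i _ => ?_
      rw [map_sum, map_sum]
      refine Finset.sum_congr rfl fun j _ => ?_
      rw [FiniteDual.ev₂_comul, FiniteDual.ev₂_comul, Algebra.TensorProduct.tmul_mul_tmul,
        TensorProduct.map_tmul]
      rfl)

end FiniteDual

end QHopf

end
noncomputable section

namespace QHopf

open scoped TensorProduct

/-! ## Sub-bialgebras, co-opposites, antipodes -/

section General

variable (k : Type*) [Field k] {H : Type*} [Ring H] [Bialgebra k H]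

open Coalgebra

/-- The inclusion `S ⊗ S → H ⊗ H`, for a subalgebra `S` of `H`. -/
def subTensor (S : Subalgebra k H) : S ⊗[k] S →ₐ[k] H ⊗[k] H :=
  Algebra.TensorProduct.map S.val S.val

variable {k}

theorem subTensor_injective (S : Subalgebra k H) : Function.Injective (subTensor k S) :=
  TensorProduct.map_injective_of_flat_flat S.val.toLinearMap S.val.toLinearMap
    Subtype.val_injective Subtype.val_injective

/-- The restriction to `S` of the comultiplication of `H`, when `Δ(S) ⊆ S ⊗ S`. -/
def subComul (S : Subalgebra k H) (hS : ∀ x ∈ S, comul (R := k) x ∈ (subTensor k S).range) :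
    S →ₗ[k] S ⊗[k] S :=
  LinearMap.codRestrictOfInjective (comul (R := k) ∘ₗ S.val.toLinearMap)
    (subTensor k S).toLinearMap (subTensor_injective S) (fun x => hS x x.2)

theorem subTensor_subComul (S : Subalgebra k H)
    (hS : ∀ x ∈ S, comul (R := k) x ∈ (subTensor k S).range) (x : S) :
    subTensor k S (subComul S hS x) = comul (R := k) (x : H) :=
  LinearMap.codRestrictOfInjective_comp_apply _ (subTensor k S).toLinearMap _ _ x

set_option synthInstance.maxHeartbeats 200000 in
/-- The bialgebra structure on a subalgebra `S` with `Δ(S) ⊆ S ⊗ S`, with the restrictions of the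
comultiplication and of the counit of the ambient bialgebra. -/
@[reducible] def subBialgebra (S : Subalgebra k H)
    (hS : ∀ x ∈ S, comul (R := k) x ∈ (subTensor k S).range) : Bialgebra k S :=
  letI : Coalgebra k S :=
    { comul := subComul S hS
      counit := counit (R := k) ∘ₗ S.val.toLinearMap
      coassoc := by
        refine LinearMap.ext fun x => ?_
        have hinj : Function.Injective (TensorProduct.map S.val.toLinearMap
            (TensorProduct.map S.val.toLinearMap S.val.toLinearMap)) :=
          TensorProduct.map_injective_of_flat_flat _ _ Subtype.val_injective (subTensor_injective S)
        apply hinj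
        have h1 : ∀ t : S ⊗[k] S,
            TensorProduct.map S.val.toLinearMap
              (TensorProduct.map S.val.toLinearMap S.val.toLinearMap)
              (TensorProduct.assoc k S S S ((subComul S hS).rTensor S t)) =
            TensorProduct.assoc k H H H ((comul (R := k)).rTensor H (subTensor k S t)) := by
          intro t
          induction t with
          | zero => simp
          | add u v hu hv => simp only [map_add, hu, hv]
          | tmul a b =>
            have : subTensor k S (a ⊗ₜ b) = (a : H) ⊗ₜ (b : H) := rfl
            rw [this, LinearMap.rTensor_tmul, LinearMap.rTensor_tmul, ← subTensor_subComul S hS a]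
            induction subComul S hS a with
            | zero => simp
            | add u v hu hv => simp only [map_add, TensorProduct.add_tmul, hu, hv]
            | tmul c d => rfl
        have h2 : ∀ t : S ⊗[k] S,
            TensorProduct.map S.val.toLinearMap
              (TensorProduct.map S.val.toLinearMap S.val.toLinearMap)
              ((subComul S hS).lTensor S t) =
            (comul (R := k)).lTensor H (subTensor k S t) := by
          intro t
          induction t with
          | zero => simp
          | add u v hu hv => simp only [map_add, hu, hv]
          | tmul a b =>
            have : subTensor k S (a ⊗ₜ b) = (a : H) ⊗ₜ (b : H) := rfl
            rw [this, LinearMap.lTensor_tmul, LinearMap.lTensor_tmul, ← subTensor_subComul S hS b]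
            rfl
        refine (h1 _).trans (Eq.trans ?_ (h2 _).symm)
        rw [subTensor_subComul, coassoc_apply]
      rTensor_counit_comp_comul := by
        refine LinearMap.ext fun x => (TensorProduct.lid k S).injective (Subtype.ext ?_)
        have h : ∀ t : S ⊗[k] S,
            (TensorProduct.lid k S ((counit (R := k) ∘ₗ S.val.toLinearMap).rTensor S t) : H) =
              TensorProduct.lid k H ((counit (R := k)).rTensor H (subTensor k S t)) := by
          intro t
          induction t with
          | zero => simp
          | add u v hu hv => simp only [map_add, Subalgebra.coe_add, hu, hv]
          | tmul a b => rfl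
        refine (h _).trans ?_
        rw [subTensor_subComul, rTensor_counit_comul]
        rfl
      lTensor_counit_comp_comul := by
        refine LinearMap.ext fun x => (TensorProduct.rid k S).injective (Subtype.ext ?_)
        have h : ∀ t : S ⊗[k] S,
            (TensorProduct.rid k S ((counit (R := k) ∘ₗ S.val.toLinearMap).lTensor S t) : H) =
              TensorProduct.rid k H ((counit (R := k)).lTensor H (subTensor k S t)) := by
          intro t
          induction t with
          | zero => simp
          | add u v hu hv => simp only [map_add, Subalgebra.coe_add, hu, hv]
          | tmul a b => rfl
        refine (h _).trans ?_
        rw [subTensor_subComul, lTensor_counit_comul]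
        rfl }
  Bialgebra.mk' k S
    (by
      change counit (R := k) (1 : H) = 1
      exact Bialgebra.counit_one)
    (by
      intro a b
      change counit (R := k) ((a : H) * (b : H)) = counit (R := k) (a : H) * counit (R := k) (b : H)
      exact Bialgebra.counit_mul _ _)
    (by
      apply subTensor_injective S
      change subTensor k S (subComul S hS 1) = _
      rw [subTensor_subComul, map_one]
      exact Bialgebra.comul_one)
    (by
      intro a b
      apply subTensor_injective S
      change subTensor k S (subComul S hS (a * b)) =
        subTensor k S (subComul S hS a * subComul S hS b)
      rw [map_mul (subTensor k S), subTensor_subComul, subTensor_subComul, subTensor_subComul]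
      exact Bialgebra.comul_mul _ _)

variable (k H)

/-- The opposite comultiplication `Δ^cop(x) = ∑ x₂ ⊗ x₁`. -/
def copComul : H →ₗ[k] H ⊗[k] H :=
  (TensorProduct.comm k H H).toLinearMap ∘ₗ comul (R := k) (A := H)

theorem copComul_coassoc :
    (TensorProduct.assoc k H H H).toLinearMap ∘ₗ (copComul k H).rTensor H ∘ₗ copComul k H =
      (copComul k H).lTensor H ∘ₗ copComul k H := by
  refine LinearMap.ext fun x => ?_
  have h1 : ∀ t : H ⊗[k] H, TensorProduct.assoc k H H H
      (((TensorProduct.comm k H H).toLinearMap ∘ₗ comul (R := k) (A := H)).rTensor H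
        (TensorProduct.comm k H H t)) =
      TensorProduct.assoc k H H H ((TensorProduct.comm k H H).toLinearMap.rTensor H
        (TensorProduct.comm k H (H ⊗[k] H) ((comul (R := k) (A := H)).lTensor H t))) := by
    intro t
    induction t with
    | zero => simp
    | add u v hu hv => simp only [map_add, hu, hv]
    | tmul a b => rfl
  have h2 : ∀ t : H ⊗[k] H,
      ((TensorProduct.comm k H H).toLinearMap ∘ₗ comul (R := k) (A := H)).lTensor H
        (TensorProduct.comm k H H t) =
      (TensorProduct.comm k H H).toLinearMap.lTensor H
        (TensorProduct.comm k (H ⊗[k] H) H ((comul (R := k) (A := H)).rTensor H t)) := by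
    intro t
    induction t with
    | zero => simp
    | add u v hu hv => simp only [map_add, hu, hv]
    | tmul a b => rfl
  have h3 : ∀ t : (H ⊗[k] H) ⊗[k] H,
      TensorProduct.assoc k H H H ((TensorProduct.comm k H H).toLinearMap.rTensor H
        (TensorProduct.comm k H (H ⊗[k] H) (TensorProduct.assoc k H H H t))) =
      (TensorProduct.comm k H H).toLinearMap.lTensor H
        (TensorProduct.comm k (H ⊗[k] H) H t) := by
    intro t
    induction t with
    | zero => simp
    | add u v hu hv => simp only [map_add, hu, hv]
    | tmul t c =>
      induction t with
      | zero => simp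
      | add u v hu hv => simp only [map_add, TensorProduct.add_tmul, hu, hv]
      | tmul a b => rfl
  refine (h1 _).trans (Eq.trans ?_ (h2 _).symm)
  rw [← h3, coassoc_apply]

theorem copComul_rTensor_counit :
    (counit (R := k) (A := H)).rTensor H ∘ₗ copComul k H = TensorProduct.mk k k H 1 := by
  refine LinearMap.ext fun x => ?_
  have h : ∀ t : H ⊗[k] H, (counit (R := k) (A := H)).rTensor H (TensorProduct.comm k H H t) =
      TensorProduct.comm k H k ((counit (R := k) (A := H)).lTensor H t) := by
    intro t
    induction t with
    | zero => simp
    | add u v hu hv => simp only [map_add, hu, hv]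
    | tmul a b => rfl
  refine (h _).trans ?_
  rw [lTensor_counit_comul]
  rfl

theorem copComul_lTensor_counit :
    (counit (R := k) (A := H)).lTensor H ∘ₗ copComul k H = (TensorProduct.mk k H k).flip 1 := by
  refine LinearMap.ext fun x => ?_
  have h : ∀ t : H ⊗[k] H, (counit (R := k) (A := H)).lTensor H (TensorProduct.comm k H H t) =
      TensorProduct.comm k k H ((counit (R := k) (A := H)).rTensor H t) := by
    intro t
    induction t with
    | zero => simp
    | add u v hu hv => simp only [map_add, hu, hv]
    | tmul a b => rfl
  refine (h _).trans ?_
  rw [rTensor_counit_comul]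
  rfl

theorem copComul_one : copComul k H 1 = 1 := by
  change TensorProduct.comm k H H (comul (R := k) (1 : H)) = 1
  rw [Bialgebra.comul_one]
  rfl

theorem copComul_mul (a b : H) : copComul k H (a * b) = copComul k H a * copComul k H b := by
  change Algebra.TensorProduct.comm k H H (comul (R := k) (a * b)) =
    Algebra.TensorProduct.comm k H H (comul (R := k) a) *
      Algebra.TensorProduct.comm k H H (comul (R := k) b)
  rw [Bialgebra.comul_mul, map_mul]

/-- The co-opposite `H^cop`: the same algebra with the opposite comultiplication. -/
def Cop : Type _ := H

instance : Ring (Cop H) := inferInstanceAs (Ring H)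

instance : Algebra k (Cop H) := inferInstanceAs (Algebra k H)

/-- The identity map from `H^cop` to `H`. -/
def Cop.toBase : Cop H ≃ₐ[k] H := (AlgEquiv.refl : H ≃ₐ[k] H)

/-- The comultiplication of `H^cop` is opposite to that of `H`, the counit is the same. -/
instance : Bialgebra k (Cop H) :=
  letI : Coalgebra k (Cop H) :=
    { comul := copComul k H
      counit := counit (R := k) (A := H)
      coassoc := copComul_coassoc k H
      rTensor_counit_comp_comul := copComul_rTensor_counit k H
      lTensor_counit_comp_comul := copComul_lTensor_counit k H }
  Bialgebra.mk' k (Cop H) (Bialgebra.counit_one (R := k) (A := H))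
    (Bialgebra.counit_mul (R := k) (A := H) _ _) (copComul_one k H) (copComul_mul k H _ _)

variable {k H}

/-- `S` is an antipode of `H`: it is the convolution inverse of the identity, so that `H` with `S`
is a Hopf algebra. An antipode is unique if it exists. -/
def IsAntipode (S : H →ₗ[k] H) : Prop :=
  LinearMap.mul' k H ∘ₗ S.rTensor H ∘ₗ comul = Algebra.linearMap k H ∘ₗ counit ∧
    LinearMap.mul' k H ∘ₗ S.lTensor H ∘ₗ comul = Algebra.linearMap k H ∘ₗ counit

end General

end QHopf

end
noncomputable section

namespace QHopf

open scoped TensorProduct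

/-! ## The FRT bialgebra of an operator -/

section FRT

variable {k : Type*} [Field k] {n : ℕ} (R : Fin n → Fin n → Fin n → Fin n → k)

open Coalgebra

/-- A matrix `X` over an algebra satisfies the FRT relations for the operator
`R(vᵢ ⊗ vⱼ) = ∑ R i j c d • v_c ⊗ v_d`: the coaction `vᵢ ↦ ∑ X i a ⊗ v_a` commutes with `R`. -/
def RTT {B : Type*} [Ring B] [Algebra k B] (X : Fin n → Fin n → B) : Prop :=
  ∀ i j c d, ∑ a, ∑ b, R i j a b • (X a c * X b d) = ∑ a, ∑ b, R a b c d • (X i a * X j b)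

/-- The Yang-Baxter equation `R₁₂ R₂₃ R₁₂ = R₂₃ R₁₂ R₂₃` in coordinates. -/
def YangBaxter : Prop :=
  ∀ i j s u v w,
    ∑ a, ∑ b, ∑ m, R i j a b * (R b s m w * R a m u v) =
      ∑ a, ∑ b, ∑ m, R j s a b * (R i a u m * R m b v w)

/-- The defining relations of `A(R)`, in the free algebra on the `T i j`. -/
inductive FRTRel : FreeAlgebra k (Fin n × Fin n) → FreeAlgebra k (Fin n × Fin n) → Prop
  | rtt (i j c d : Fin n) : FRTRel
      (∑ a, ∑ b, R i j a b • (FreeAlgebra.ι k (a, c) * FreeAlgebra.ι k (b, d)))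
      (∑ a, ∑ b, R a b c d • (FreeAlgebra.ι k (i, a) * FreeAlgebra.ι k (j, b)))

/-- The FRT algebra `A(R)`. -/
def FRTAlgebra : Type _ := RingQuot (FRTRel R)

instance : Ring (FRTAlgebra R) := inferInstanceAs (Ring (RingQuot (FRTRel R)))

instance : Algebra k (FRTAlgebra R) := inferInstanceAs (Algebra k (RingQuot (FRTRel R)))

/-- The projection from the free algebra. -/
def FRTAlgebra.proj : FreeAlgebra k (Fin n × Fin n) →ₐ[k] FRTAlgebra R :=
  RingQuot.mkAlgHom k (FRTRel R)

/-- The generator `T_i^j` of `A(R)`. -/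
def FRTAlgebra.T (i j : Fin n) : FRTAlgebra R := FRTAlgebra.proj R (FreeAlgebra.ι k (i, j))

theorem FRTAlgebra.rtt : RTT R (FRTAlgebra.T R) := by
  intro i j c d
  have h := RingQuot.mkAlgHom_rel k (FRTRel.rtt (R := R) i j c d)
  have h' : FRTAlgebra.proj R _ = FRTAlgebra.proj R _ := h
  simp only [map_sum, map_smul, map_mul] at h'
  exact h'

variable {R}

/-- The universal property of `A(R)`. -/
def FRTAlgebra.lift {B : Type*} [Ring B] [Algebra k B] (X : Fin n → Fin n → B) (hX : RTT R X) :
    FRTAlgebra R →ₐ[k] B :=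
  RingQuot.liftAlgHom k ⟨FreeAlgebra.lift k fun p => X p.1 p.2, by
    rintro _ _ ⟨i, j, c, d⟩
    simpa only [map_sum, map_smul, map_mul, FreeAlgebra.lift_ι_apply] using hX i j c d⟩

@[simp] theorem FRTAlgebra.lift_T {B : Type*} [Ring B] [Algebra k B] (X : Fin n → Fin n → B)
    (hX : RTT R X) (i j : Fin n) : FRTAlgebra.lift X hX (FRTAlgebra.T R i j) = X i j := by
  refine (RingQuot.liftAlgHom_mkAlgHom_apply k _ _ _).trans ?_
  rw [FreeAlgebra.lift_ι_apply]

theorem FRTAlgebra.algHom_ext {B : Type*} [Ring B] [Algebra k B] {f g : FRTAlgebra R →ₐ[k] B}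
    (h : ∀ i j, f (FRTAlgebra.T R i j) = g (FRTAlgebra.T R i j)) : f = g := by
  refine RingQuot.ringQuot_ext' k f g ?_
  refine FreeAlgebra.hom_ext (funext fun p => ?_)
  exact h p.1 p.2

theorem FRTAlgebra.adjoin_T :
    Algebra.adjoin k (Set.range fun p : Fin n × Fin n => FRTAlgebra.T R p.1 p.2) = ⊤ := by
  have h1 : (FRTAlgebra.proj R).range = ⊤ :=
    (AlgHom.range_eq_top _).2 (RingQuot.mkAlgHom_surjective k (FRTRel R))
  rw [← h1, ← Algebra.map_top, ← FreeAlgebra.adjoin_range_ι, AlgHom.map_adjoin, ← Set.range_comp]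
  rfl

theorem FRTAlgebra.mem_of_T (S : Subalgebra k (FRTAlgebra R)) (h : ∀ i j, FRTAlgebra.T R i j ∈ S)
    (a : FRTAlgebra R) : a ∈ S := by
  have h1 : (⊤ : Subalgebra k (FRTAlgebra R)) ≤ S := by
    rw [← FRTAlgebra.adjoin_T]
    refine Algebra.adjoin_le ?_
    rintro _ ⟨p, rfl⟩
    exact h _ _
  exact h1 trivial

variable (R)

/-- The matrix `∑ₘ T_i^m ⊗ T_m^j`. -/
def FRTAlgebra.ΔT (i j : Fin n) : FRTAlgebra R ⊗[k] FRTAlgebra R :=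
  ∑ m, FRTAlgebra.T R i m ⊗ₜ FRTAlgebra.T R m j

theorem FRTAlgebra.rtt_ΔT : RTT R (FRTAlgebra.ΔT R) := by
  intro i j c d
  have h1 : ∀ a b c d, FRTAlgebra.ΔT R a c * FRTAlgebra.ΔT R b d =
      ∑ p, ∑ q, (FRTAlgebra.T R a p * FRTAlgebra.T R b q) ⊗ₜ[k]
        (FRTAlgebra.T R p c * FRTAlgebra.T R q d) := by
    intro a b c d
    rw [FRTAlgebra.ΔT, FRTAlgebra.ΔT, Finset.sum_mul_sum]
    simp only [Algebra.TensorProduct.tmul_mul_tmul]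
  have h2 : ∑ a, ∑ b, R i j a b • (FRTAlgebra.ΔT R a c * FRTAlgebra.ΔT R b d) =
      ∑ p, ∑ q, (∑ a, ∑ b, R i j a b • (FRTAlgebra.T R a p * FRTAlgebra.T R b q)) ⊗ₜ[k]
        (FRTAlgebra.T R p c * FRTAlgebra.T R q d) := by
    simp only [h1, Finset.smul_sum, TensorProduct.sum_tmul, TensorProduct.smul_tmul']
    rw [Finset.sum_congr rfl fun a _ => Finset.sum_comm]
    rw [Finset.sum_comm]
    refine Finset.sum_congr rfl fun p _ => ?_
    rw [Finset.sum_congr rfl fun a _ => Finset.sum_comm]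
    rw [Finset.sum_comm]
  have h3 : ∑ a, ∑ b, R a b c d • (FRTAlgebra.ΔT R i a * FRTAlgebra.ΔT R j b) =
      ∑ p, ∑ q, (FRTAlgebra.T R i p * FRTAlgebra.T R j q) ⊗ₜ[k]
        (∑ a, ∑ b, R a b c d • (FRTAlgebra.T R p a * FRTAlgebra.T R q b)) := by
    simp only [h1, Finset.smul_sum, TensorProduct.tmul_sum, TensorProduct.tmul_smul]
    rw [Finset.sum_congr rfl fun a _ => Finset.sum_comm]
    rw [Finset.sum_comm]
    refine Finset.sum_congr rfl fun p _ => ?_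
    rw [Finset.sum_congr rfl fun a _ => Finset.sum_comm]
    rw [Finset.sum_comm]
  rw [h2, h3]
  simp only [FRTAlgebra.rtt R i j, ← FRTAlgebra.rtt R _ _ c d]
  simp only [TensorProduct.sum_tmul, TensorProduct.tmul_sum, ← TensorProduct.smul_tmul',
    TensorProduct.tmul_smul]
  rw [Finset.sum_congr rfl fun a _ => Finset.sum_comm]
  rw [Finset.sum_comm]
  rw [Finset.sum_congr rfl fun a _ => Finset.sum_congr rfl fun b _ => Finset.sum_comm]
  rw [Finset.sum_congr rfl fun a _ => Finset.sum_comm]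

theorem FRTAlgebra.rtt_one : RTT R (fun i j : Fin n => if i = j then (1 : k) else 0) := by
  intro i j c d
  simp

/-- The bialgebra structure of `A(R)`: `Δ(T_i^j) = ∑ₘ T_i^m ⊗ T_m^j` and `ε(T_i^j) = δ_ij`. -/
instance : Bialgebra k (FRTAlgebra R) :=
  Bialgebra.ofAlgHom (FRTAlgebra.lift (FRTAlgebra.ΔT R) (FRTAlgebra.rtt_ΔT R))
    (FRTAlgebra.lift _ (FRTAlgebra.rtt_one R))
    (by
      refine FRTAlgebra.algHom_ext fun i j => ?_
      have h1 : ∀ t, (Algebra.TensorProduct.assoc k k k _ _ _).toAlgHom t =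
        TensorProduct.assoc k (FRTAlgebra R) (FRTAlgebra R) (FRTAlgebra R) t := fun _ => rfl
      simp only [AlgHom.comp_apply, FRTAlgebra.lift_T, FRTAlgebra.ΔT, map_sum,
        Algebra.TensorProduct.map_tmul, AlgHom.id_apply, TensorProduct.sum_tmul,
        TensorProduct.tmul_sum, h1, TensorProduct.assoc_tmul]
      rw [Finset.sum_comm])
    (by
      refine FRTAlgebra.algHom_ext fun i j => ?_
      simp [FRTAlgebra.lift_T, FRTAlgebra.ΔT, TensorProduct.ite_tmul])
    (by
      refine FRTAlgebra.algHom_ext fun i j => ?_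
      simp [FRTAlgebra.lift_T, FRTAlgebra.ΔT, TensorProduct.tmul_ite])

@[simp] theorem FRTAlgebra.comul_T (i j : Fin n) : comul (R := k) (FRTAlgebra.T R i j) =
    ∑ m, FRTAlgebra.T R i m ⊗ₜ FRTAlgebra.T R m j :=
  FRTAlgebra.lift_T (FRTAlgebra.ΔT R) (FRTAlgebra.rtt_ΔT R) i j

@[simp] theorem FRTAlgebra.counit_T (i j : Fin n) : counit (R := k) (FRTAlgebra.T R i j) =
    if i = j then 1 else 0 :=
  FRTAlgebra.lift_T _ (FRTAlgebra.rtt_one R) i j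

end FRT

end QHopf

end
noncomputable section

namespace QHopf

open scoped TensorProduct

/-! ## The braiding of `A(R)` -/

section Braiding

variable {k : Type*} [Field k] {n : ℕ} {R : Fin n → Fin n → Fin n → Fin n → k}

open Coalgebra MulOpposite

theorem rtt_genMat (hR : YangBaxter R) :
    RTT R (fun s t => Matrix.of fun i j : Fin n => R i s t j) := by
  intro s t u v
  ext i j
  have h := hR i s t u v j
  simp only [Matrix.sum_apply, Matrix.smul_apply, Matrix.mul_apply, Matrix.of_apply, smul_eq_mul,
    Finset.mul_sum]
  rw [← h]
  refine Finset.sum_congr rfl fun a _ => ?_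
  rw [Finset.sum_comm]
  refine Finset.sum_congr rfl fun b _ => Finset.sum_congr rfl fun m _ => ?_
  ring

/-- The representation `a ↦ (⟨T_i^j | a⟩)_{i j}` of `A(R)`. -/
def genRep (hR : YangBaxter R) : FRTAlgebra R →ₐ[k] Matrix (Fin n) (Fin n) k :=
  FRTAlgebra.lift _ (rtt_genMat hR)

@[simp] theorem genRep_T (hR : YangBaxter R) (s t i j : Fin n) :
    genRep hR (FRTAlgebra.T R s t) i j = R i s t j := by
  rw [genRep, FRTAlgebra.lift_T, Matrix.of_apply]

/-- The functional `⟨T_i^j | -⟩` on `A(R)`. -/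
def genFun (hR : YangBaxter R) (i j : Fin n) : FiniteDual k (FRTAlgebra R) :=
  FiniteDual.mk (Matrix.entryLinearMap k k i j ∘ₗ (genRep hR).toLinearMap)
    (VanishesOnCofiniteIdeal.of_factor (genRep hR) (Matrix.entryLinearMap k k i j) fun _ => rfl)

theorem genFun_apply (hR : YangBaxter R) (i j : Fin n) (x : FRTAlgebra R) :
    genFun hR i j x = genRep hR x i j := rfl

theorem FiniteDual.mul_apply_T (f g : FiniteDual k (FRTAlgebra R)) (i j : Fin n) :
    (f * g) (FRTAlgebra.T R i j) = ∑ m, f (FRTAlgebra.T R i m) * g (FRTAlgebra.T R m j) := by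
  rw [FiniteDual.mul_apply, FRTAlgebra.comul_T, map_sum, map_sum]
  rfl

theorem FiniteDual.sum_apply {H ι : Type*} [Ring H] [Bialgebra k H] (s : Finset ι)
    (f : ι → FiniteDual k H) (x : H) : (∑ i ∈ s, f i) x = ∑ i ∈ s, f i x :=
  map_sum (FiniteDual.ev x) f s

/-- The tensor square of `genRep`. -/
def genRep₂ (hR : YangBaxter R) :
    FRTAlgebra R →ₐ[k] Matrix (Fin n × Fin n) (Fin n × Fin n) k :=
  ((Matrix.kroneckerAlgEquiv (Fin n) (Fin n) k).toAlgHom.comp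
    (Algebra.TensorProduct.map (genRep hR) (genRep hR))).comp
    (Bialgebra.comulAlgHom k (FRTAlgebra R))

theorem genRep₂_apply (hR : YangBaxter R) (x : FRTAlgebra R) (i a j b : Fin n) :
    genRep₂ hR x (i, a) (j, b) = (genFun hR i j * genFun hR a b) x := by
  rw [FiniteDual.mul_apply]
  change Matrix.kroneckerAlgEquiv (Fin n) (Fin n) k
    (Algebra.TensorProduct.map (genRep hR) (genRep hR) (comul (R := k) x)) (i, a) (j, b) = _
  induction comul (R := k) x with
  | zero => simp
  | add u v hu hv => simp only [map_add, Matrix.add_apply, hu, hv]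
  | tmul u v =>
    rw [Algebra.TensorProduct.map_tmul, TensorProduct.map_tmul]
    simp
    rfl

theorem rtt_genFun (hR : YangBaxter R) : RTT R (fun i j => op (genFun hR i j)) := by
  intro i j c d
  apply unop_injective
  let X : Matrix (Fin n × Fin n) (Fin n × Fin n) k :=
    Matrix.of fun p q => R p.2 p.1 q.2 q.1
  have key : ∀ x, x ∈ (Subalgebra.centralizer k {X}).comap (genRep₂ hR) := by
    refine FRTAlgebra.mem_of_T _ fun s t => ?_
    rw [Subalgebra.mem_comap, Subalgebra.mem_centralizer_iff]
    rintro _ rfl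
    ext ⟨j, i⟩ ⟨d, c⟩
    simp only [Matrix.mul_apply, Fintype.sum_prod_type, genRep₂_apply, FiniteDual.mul_apply_T,
      genFun_apply, genRep_T, X, Matrix.of_apply, Finset.mul_sum, Finset.sum_mul]
    have h := hR i j s t c d
    rw [Finset.sum_comm]
    refine h.trans ?_
    rw [Finset.sum_comm]
    refine Finset.sum_congr rfl fun b _ => ?_
    rw [Finset.sum_comm]
    refine Finset.sum_congr rfl fun a _ => Finset.sum_congr rfl fun m _ => ?_
    ring
  refine FiniteDual.ext fun x => ?_
  have h := key x
  rw [Subalgebra.mem_comap, Subalgebra.mem_centralizer_iff] at h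
  have h2 := congrFun (congrFun (h X rfl) (j, i)) (d, c)
  simp only [Matrix.mul_apply, Fintype.sum_prod_type, genRep₂_apply, X, Matrix.of_apply] at h2
  simp only [Finset.unop_sum, unop_smul, unop_mul, unop_op, FiniteDual.sum_apply,
    FiniteDual.smul_apply]
  rw [Finset.sum_comm, h2, Finset.sum_comm]
  refine Finset.sum_congr rfl fun b _ => Finset.sum_congr rfl fun a _ => mul_comm _ _

/-- `λ⁺` as an algebra map to the opposite algebra. -/
def lambdaOp (hR : YangBaxter R) : FRTAlgebra R →ₐ[k] (FiniteDual k (FRTAlgebra R))ᵐᵒᵖ :=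
  FRTAlgebra.lift _ (rtt_genFun hR)

/-- The map `λ⁺ : A(R) → A(R)⁰`, `a ↦ ⟨a | -⟩`. It is the anti-algebra map with
`⟨T_i^l | T_j^c⟩ = R i j c l`. -/
def lambdaPlus (hR : YangBaxter R) : FRTAlgebra R →ₗ[k] FiniteDual k (FRTAlgebra R) :=
  (opLinearEquiv k).symm.toLinearMap ∘ₗ (lambdaOp hR).toLinearMap

/-- The braiding `⟨a | b⟩` of `A(R)`. It is determined by its values `⟨T_i^l | T_j^c⟩ = R i j c l`
on generators and by `⟨aa' | b⟩ = ∑ ⟨a' | b₁⟩⟨a | b₂⟩`, `⟨a | bb'⟩ = ∑ ⟨a₁ | b⟩⟨a₂ | b'⟩`,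
`⟨1 | b⟩ = ε(b)`, `⟨a | 1⟩ = ε(a)`. -/
def braiding (hR : YangBaxter R) : FRTAlgebra R →ₗ[k] FRTAlgebra R →ₗ[k] k :=
  LinearMap.mk₂ k (fun a b => lambdaPlus hR a b)
    (fun a a' b => by rw [map_add, FiniteDual.add_apply])
    (fun c a b => by rw [map_smul, FiniteDual.smul_apply, smul_eq_mul])
    (fun a b b' => map_add _ b b') (fun c a b => map_smul _ c b)

theorem lambdaPlus_apply (hR : YangBaxter R) (a b : FRTAlgebra R) :
    lambdaPlus hR a b = braiding hR a b := rfl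

theorem lambdaPlus_T (hR : YangBaxter R) (i j : Fin n) :
    lambdaPlus hR (FRTAlgebra.T R i j) = genFun hR i j := by
  change unop (lambdaOp hR (FRTAlgebra.T R i j)) = _
  rw [lambdaOp, FRTAlgebra.lift_T, unop_op]

theorem lambdaPlus_one (hR : YangBaxter R) : lambdaPlus hR 1 = 1 := by
  change unop (lambdaOp hR 1) = _
  rw [map_one, unop_one]

theorem lambdaPlus_mul (hR : YangBaxter R) (a a' : FRTAlgebra R) :
    lambdaPlus hR (a * a') = lambdaPlus hR a' * lambdaPlus hR a := by
  change unop (lambdaOp hR (a * a')) = _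
  rw [map_mul, unop_mul]
  rfl

theorem braiding_T_T (hR : YangBaxter R) (i l j c : Fin n) :
    braiding hR (FRTAlgebra.T R i l) (FRTAlgebra.T R j c) = R i j c l := by
  rw [← lambdaPlus_apply, lambdaPlus_T, genFun_apply, genRep_T]

theorem comul_genFun (hR : YangBaxter R) (i j : Fin n) :
    comul (R := k) (genFun hR i j) = ∑ m, genFun hR i m ⊗ₜ genFun hR m j := by
  refine FiniteDual.tensor_ext fun x y => ?_
  rw [FiniteDual.ev₂_comul, genFun_apply, map_mul, Matrix.mul_apply, map_sum]
  rfl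

/-- `λ⁺` is a coalgebra map. -/
theorem comul_lambdaPlus (hR : YangBaxter R) (a : FRTAlgebra R) :
    comul (R := k) (lambdaPlus hR a) =
      TensorProduct.map (lambdaPlus hR) (lambdaPlus hR) (comul (R := k) a) := by
  have hanti : ∀ s t : FRTAlgebra R ⊗[k] FRTAlgebra R,
      TensorProduct.map (lambdaPlus hR) (lambdaPlus hR) (s * t) =
        TensorProduct.map (lambdaPlus hR) (lambdaPlus hR) t *
          TensorProduct.map (lambdaPlus hR) (lambdaPlus hR) s := by
    intro s t
    induction s with
    | zero => simp
    | add u v hu hv => simp only [add_mul, mul_add, map_add, hu, hv]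
    | tmul a b =>
      induction t with
      | zero => simp
      | add u v hu hv => simp only [add_mul, mul_add, map_add, hu, hv]
      | tmul c d =>
        simp only [Algebra.TensorProduct.tmul_mul_tmul, TensorProduct.map_tmul, lambdaPlus_mul]
  have hone : TensorProduct.map (lambdaPlus hR) (lambdaPlus hR) 1 = 1 := by
    rw [Algebra.TensorProduct.one_def, TensorProduct.map_tmul, lambdaPlus_one]
    rfl
  let S : Subalgebra k (FRTAlgebra R) :=
    { carrier := {a | comul (R := k) (lambdaPlus hR a) =
        TensorProduct.map (lambdaPlus hR) (lambdaPlus hR) (comul (R := k) a)}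
      mul_mem' := by
        intro a b ha hb
        simp only [Set.mem_ofPred_eq] at ha hb ⊢
        rw [lambdaPlus_mul, Bialgebra.comul_mul, Bialgebra.comul_mul, hanti, ha, hb]
      add_mem' := by
        intro a b ha hb
        simp only [Set.mem_ofPred_eq] at ha hb ⊢
        simp only [map_add, ha, hb]
      algebraMap_mem' := by
        intro c
        simp only [Set.mem_ofPred_eq, Algebra.algebraMap_eq_smul_one, map_smul, lambdaPlus_one,
          Bialgebra.comul_one, hone] }
  refine FRTAlgebra.mem_of_T S (fun i j => ?_) a
  change comul (R := k) (lambdaPlus hR _) = TensorProduct.map _ _ (comul (R := k) _)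
  rw [lambdaPlus_T, comul_genFun, FRTAlgebra.comul_T, map_sum]
  simp only [TensorProduct.map_tmul, lambdaPlus_T]

theorem braiding_mul_left (hR : YangBaxter R) (a a' b : FRTAlgebra R) :
    braiding hR (a * a') b =
      LinearMap.mul' k k (TensorProduct.map (braiding hR a') (braiding hR a) (comul b)) := by
  rw [← lambdaPlus_apply, lambdaPlus_mul]
  rfl

theorem braiding_mul_right (hR : YangBaxter R) (a b b' : FRTAlgebra R) :
    braiding hR a (b * b') = LinearMap.mul' k k
      (TensorProduct.map ((braiding hR).flip b) ((braiding hR).flip b') (comul a)) := by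
  rw [← lambdaPlus_apply, ← FiniteDual.ev₂_comul, comul_lambdaPlus]
  induction comul (R := k) a with
  | zero => simp
  | add u v hu hv => simp only [map_add, hu, hv]
  | tmul u v => rfl

theorem braiding_one_left (hR : YangBaxter R) (b : FRTAlgebra R) :
    braiding hR 1 b = counit b := by
  rw [← lambdaPlus_apply, lambdaPlus_one, FiniteDual.one_apply]

theorem braiding_one_right (hR : YangBaxter R) (a : FRTAlgebra R) :
    braiding hR a 1 = counit a := by
  let S : Subalgebra k (FRTAlgebra R) :=
    { carrier := {a | braiding hR a 1 = counit (R := k) a}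
      mul_mem' := by
        intro a b ha hb
        simp only [Set.mem_ofPred_eq] at ha hb ⊢
        rw [braiding_mul_left, Bialgebra.comul_one, Bialgebra.counit_mul, ← ha, ← hb, mul_comm]
        rfl
      add_mem' := by
        intro a b ha hb
        simp only [Set.mem_ofPred_eq] at ha hb ⊢
        simp only [map_add, LinearMap.add_apply, ha, hb]
      algebraMap_mem' := by
        intro c
        simp only [Set.mem_ofPred_eq, Algebra.algebraMap_eq_smul_one, map_smul, LinearMap.smul_apply,
          braiding_one_left] }
  refine FRTAlgebra.mem_of_T S (fun i j => ?_) a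
  change braiding hR _ 1 = counit (R := k) _
  rw [← lambdaPlus_apply, lambdaPlus_T, genFun_apply, map_one, FRTAlgebra.counit_T,
    Matrix.one_apply]

/-- The representation `a ↦ (⟨a | T_i^j⟩)_{j i}` of `A(R)`. -/
def genRep' (hR : YangBaxter R) : FRTAlgebra R →ₐ[k] Matrix (Fin n) (Fin n) k :=
  AlgHom.ofLinearMap
    { toFun := fun a => Matrix.of fun j i => braiding hR a (FRTAlgebra.T R i j)
      map_add' := fun a b => by ext; simp
      map_smul' := fun c a => by ext; simp }
    (by
      ext j i
      simp [braiding_one_left, Matrix.one_apply, eq_comm])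
    (by
      intro a b
      ext j i
      simp only [LinearMap.coe_mk, AddHom.coe_mk, Matrix.of_apply, Matrix.mul_apply]
      rw [braiding_mul_left, FRTAlgebra.comul_T, map_sum, map_sum]
      refine Finset.sum_congr rfl fun m _ => ?_
      rw [TensorProduct.map_tmul, LinearMap.mul'_apply, mul_comm])

theorem vanishes_flip_braiding (hR : YangBaxter R) (b : FRTAlgebra R) :
    VanishesOnCofiniteIdeal k (FRTAlgebra R) ((braiding hR).flip b) := by
  let ρ : FRTAlgebra R →ₐ[k] WithConv (FRTAlgebra R →ₗ[k] k) :=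
    AlgHom.ofLinearMap
      ((WithConv.linearEquiv k (FRTAlgebra R →ₗ[k] k)).symm.toLinearMap ∘ₗ (braiding hR).flip)
      (by
        apply WithConv.ext
        refine LinearMap.ext fun a => ?_
        exact braiding_one_right hR a)
      (by
        intro b b'
        apply WithConv.ext
        refine LinearMap.ext fun a => ?_
        exact braiding_mul_right hR a b b')
  refine FRTAlgebra.mem_of_T ((finiteDualSubalgebra k (FRTAlgebra R)).comap ρ) (fun i j => ?_) b
  exact VanishesOnCofiniteIdeal.of_factor (genRep' hR) (Matrix.entryLinearMap k k j i)
    fun _ => rfl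

/-- The map `ρ⁺ : A(R) → A(R)⁰`, `b ↦ ⟨- | b⟩`. -/
def rhoPlus (hR : YangBaxter R) : FRTAlgebra R →ₗ[k] FiniteDual k (FRTAlgebra R) where
  toFun b := FiniteDual.mk ((braiding hR).flip b) (vanishes_flip_braiding hR b)
  map_add' b b' := FiniteDual.ext fun a => by simp
  map_smul' c b := FiniteDual.ext fun a => by simp

theorem rhoPlus_apply (hR : YangBaxter R) (b a : FRTAlgebra R) :
    rhoPlus hR b a = braiding hR a b := rfl

theorem comul_rhoPlus_T (hR : YangBaxter R) (i j : Fin n) :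
    comul (R := k) (rhoPlus hR (FRTAlgebra.T R i j)) =
      ∑ m, rhoPlus hR (FRTAlgebra.T R m j) ⊗ₜ rhoPlus hR (FRTAlgebra.T R i m) := by
  refine FiniteDual.tensor_ext fun x y => ?_
  rw [FiniteDual.ev₂_comul, rhoPlus_apply, braiding_mul_left, FRTAlgebra.comul_T, map_sum, map_sum,
    map_sum]
  refine Finset.sum_congr rfl fun m _ => ?_
  rw [TensorProduct.map_tmul, LinearMap.mul'_apply, mul_comm]
  rfl

end Braiding

end QHopf

end
noncomputable section

namespace QHopf

open scoped TensorProduct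

/-! ## The operator `R_Q` and the Hopf algebras `B^l`, `B^r` -/

/-- The multiparameter `Q = {r, p_ij (i < j)}` of nonzero scalars, with `r ≠ 1`. Only the values
`p i j` with `i < j` are used. -/
structure Multiparameter (k : Type*) [Field k] (n : ℕ) where
  r : k
  p : Fin n → Fin n → k
  r_ne_zero : r ≠ 0
  r_ne_one : r ≠ 1
  p_ne_zero : ∀ i j, i < j → p i j ≠ 0

namespace Multiparameter

variable {k : Type*} [Field k] {n : ℕ} (Q : Multiparameter k n)

open Coalgebra

/-- `κ i j` is the scalar `κ_j^i`: it is `p_ij` if `i < j`, `r` if `i = j`, and `r / p_ji` if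
`i > j`. -/
def κ (i j : Fin n) : k :=
  if i < j then Q.p i j else if i = j then Q.r else Q.r / Q.p j i

/-- The coefficients `R i j c d = R_ij^cd` of `R_Q(vᵢ ⊗ vⱼ) = ∑ R_ij^cd v_c ⊗ v_d`. -/
def R (i j c d : Fin n) : k :=
  if i = d ∧ j = c then Q.κ i j else if i = c ∧ j = d ∧ j < i then Q.r - 1 else 0

theorem κ_self (i : Fin n) : Q.κ i i = Q.r := by simp [κ]

theorem κ_mul_κ {i j : Fin n} (h : i ≠ j) : Q.κ i j * Q.κ j i = Q.r := by
  rcases lt_or_gt_of_ne h with h | h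
  · have := Q.p_ne_zero i j h
    simp only [κ, h, h.not_gt, h.ne', if_true, if_false]
    field_simp
  · have := Q.p_ne_zero j i h
    simp only [κ, h, h.not_gt, h.ne', if_true, if_false]
    field_simp

theorem κ_ne_zero (i j : Fin n) : Q.κ i j ≠ 0 := by
  rcases eq_or_ne i j with rfl | h
  · rw [κ_self]; exact Q.r_ne_zero
  · intro h0
    have := Q.κ_mul_κ h
    rw [h0, zero_mul] at this
    exact Q.r_ne_zero this.symm

/-- The coefficient of `vᵢ ⊗ vⱼ` in `R_Q(vᵢ ⊗ vⱼ)`, for `i ≠ j`. -/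
def dd (i j : Fin n) : k := if j < i then Q.r - 1 else 0

/-- The Kronecker delta. -/
def δ (k : Type*) [Field k] {n : ℕ} (i j : Fin n) : k := if i = j then 1 else 0

theorem R_eq (i j c d : Fin n) :
    Q.R i j c d = Q.κ i j * (δ k i d * δ k j c) + Q.dd i j * (δ k i c * δ k j d) := by
  unfold R dd δ
  by_cases h1 : i = d <;> by_cases h2 : j = c <;> by_cases h3 : i = c <;> by_cases h4 : j = d <;>
    simp_all

theorem sum_R (i j : Fin n) (f : Fin n → Fin n → k) :
    ∑ a, ∑ b, Q.R i j a b * f a b = Q.κ i j * f j i + Q.dd i j * f i j := by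
  simp [R_eq, δ, add_mul, Finset.sum_add_distrib, ite_mul]

theorem sum_R_R (i j s u v w : Fin n) :
    ∑ m, Q.R j s m w * Q.R i m u v =
      Q.κ j s * δ k j w * Q.R i s u v + Q.dd j s * δ k s w * Q.R i j u v := by
  simp only [Q.R_eq j s, add_mul, Finset.sum_add_distrib]
  congr 1 <;> simp [δ, ite_mul]

theorem sum_R_R' (i j s u v w : Fin n) :
    ∑ m, Q.R i j u m * Q.R m s v w =
      Q.κ i j * δ k j u * Q.R i s v w + Q.dd i j * δ k i u * Q.R j s v w := by
  simp only [Q.R_eq i j, add_mul, Finset.sum_add_distrib]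
  congr 1 <;> simp [δ, ite_mul]

theorem dd_of_lt {i j : Fin n} (h : i < j) : Q.dd i j = 0 := if_neg h.not_gt

theorem dd_of_gt {i j : Fin n} (h : j < i) : Q.dd i j = Q.r - 1 := if_pos h

theorem dd_self (i : Fin n) : Q.dd i i = 0 := if_neg (lt_irrefl i)

theorem yangBaxter : YangBaxter Q.R := by
  intro i j s u v w
  have hL : ∑ a, ∑ b, ∑ m, Q.R i j a b * (Q.R b s m w * Q.R a m u v) =
      ∑ a, ∑ b, Q.R i j a b * ∑ m, Q.R b s m w * Q.R a m u v := by
    simp only [Finset.mul_sum]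
  have hR : ∑ a, ∑ b, ∑ m, Q.R j s a b * (Q.R i a u m * Q.R m b v w) =
      ∑ a, ∑ b, Q.R j s a b * ∑ m, Q.R i a u m * Q.R m b v w := by
    simp only [Finset.mul_sum]
  rw [hL, hR, sum_R, sum_R, sum_R_R, sum_R_R, sum_R_R', sum_R_R']
  simp only [R_eq]
  -- the coefficients of the permuted tensors agree, by cases on the order of the indices
  rcases eq_or_ne i j with hij | hij
  · subst hij
    rcases eq_or_ne i s with his | his
    · subst his
      simp only [dd_self]
      ring
    · have h1 := Q.κ_mul_κ his
      rcases lt_or_gt_of_ne his with h | h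
      · simp only [dd_self, Q.dd_of_lt h, κ_self]
        ring
      · simp only [dd_self, Q.dd_of_gt h, Q.dd_of_lt h, κ_self]
        linear_combination (-(Q.r - 1) * δ k i u * δ k i v * δ k s w) * h1
  · rcases eq_or_ne j s with hjs | hjs
    · subst hjs
      have h1 := Q.κ_mul_κ hij
      rcases lt_or_gt_of_ne hij with h | h
      · simp only [dd_self, Q.dd_of_lt h, κ_self]
        ring
      · simp only [dd_self, Q.dd_of_gt h, Q.dd_of_lt h, κ_self]
        linear_combination ((Q.r - 1) * δ k i u * δ k j v * δ k j w) * h1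
    · have h1 := Q.κ_mul_κ hij
      have h2 := Q.κ_mul_κ hjs
      rcases eq_or_ne i s with his | his
      · subst his
        rcases lt_or_gt_of_ne hij with h | h
        · simp only [dd_self, Q.dd_of_lt h, Q.dd_of_gt h, κ_self]
          ring
        · simp only [dd_self, Q.dd_of_lt h, Q.dd_of_gt h, κ_self]
          ring
      · rcases lt_or_gt_of_ne hij with h | h <;> rcases lt_or_gt_of_ne hjs with h' | h' <;>
          rcases lt_or_gt_of_ne his with h'' | h'' <;>
          simp only [Q.dd_of_lt h, Q.dd_of_gt h, Q.dd_of_lt h', Q.dd_of_gt h', Q.dd_of_lt h'',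
            Q.dd_of_gt h'']
        all_goals first
          | ring1
          | linear_combination ((Q.r - 1) * δ k i u * δ k j v * δ k s w) * (h1 - h2)
          | (exfalso; order)

/-- The FRT bialgebra `A(R_Q)`. -/
abbrev A : Type _ := FRTAlgebra Q.R

/-- The generator `T_i^j` of `A(R_Q)`. -/
def T (i j : Fin n) : Q.A := FRTAlgebra.T Q.R i j

/-- The braiding `⟨a | b⟩` of `A(R_Q)`. -/
def form : Q.A →ₗ[k] Q.A →ₗ[k] k := braiding Q.yangBaxter

/-- `λ⁺(a) = ⟨a | -⟩`. -/
def lam : Q.A →ₗ[k] FiniteDual k Q.A := lambdaPlus Q.yangBaxter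

/-- `ρ⁺(b) = ⟨- | b⟩`. -/
def rho : Q.A →ₗ[k] FiniteDual k Q.A := rhoPlus Q.yangBaxter

theorem form_T_T (i l j c : Fin n) : Q.form (Q.T i l) (Q.T j c) = Q.R i j c l :=
  braiding_T_T _ i l j c

theorem lam_apply (a b : Q.A) : Q.lam a b = Q.form a b := rfl

theorem rho_apply (a b : Q.A) : Q.rho b a = Q.form a b := rfl

theorem rtt_diag (c : Fin n → k) : RTT Q.R (fun i j => c i * δ k i j) := by
  intro i j u v
  have h1 : ∑ a, ∑ b, Q.R i j a b • (c a * δ k a u * (c b * δ k b v)) =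
      Q.R i j u v * (c u * c v) := by
    simp [δ]
  have h2 : ∑ a, ∑ b, Q.R a b u v • (c i * δ k i a * (c j * δ k j b)) =
      Q.R i j u v * (c i * c j) := by
    simp [δ]
  rw [h1, h2]
  unfold R
  split_ifs with h h'
  · rw [h.1, h.2, mul_comm (c u)]
  · rw [h'.1, h'.2.1]
  · simp

/-- The algebra map `A(R_Q) → k` with `T_i^j ↦ δ_ij c_i`, as an element of `A(R_Q)⁰`. -/
def diag (c : Fin n → k) : FiniteDual k Q.A :=
  FiniteDual.mk (FRTAlgebra.lift _ (Q.rtt_diag c)).toLinearMap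
    (VanishesOnCofiniteIdeal.of_factor (FRTAlgebra.lift _ (Q.rtt_diag c)) LinearMap.id
      fun _ => rfl)

theorem diag_T (c : Fin n → k) (i j : Fin n) :
    Q.diag c (Q.T i j) = if i = j then c i else 0 := by
  refine (FRTAlgebra.lift_T _ (Q.rtt_diag c) i j).trans ?_
  simp [δ]

theorem comul_diag (c : Fin n → k) :
    comul (R := k) (Q.diag c) = Q.diag c ⊗ₜ[k] Q.diag c := by
  refine FiniteDual.tensor_ext fun x y => ?_
  rw [FiniteDual.ev₂_comul, FiniteDual.ev₂_tmul]
  exact map_mul (FRTAlgebra.lift _ (Q.rtt_diag c)) x y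

/-- The group-like element `K_i` with `K_i(T_j^l) = δ_jl κ_j^i`. -/
def K (i : Fin n) : FiniteDual k Q.A := Q.diag fun j => Q.κ i j

/-- The inverse of `K_i`. -/
def Kinv (i : Fin n) : FiniteDual k Q.A := Q.diag fun j => (Q.κ i j)⁻¹

/-- The group-like element `L_i` with `L_i(T_j^l) = δ_jl (κ_i^j)⁻¹`. -/
def L (i : Fin n) : FiniteDual k Q.A := Q.diag fun j => (Q.κ j i)⁻¹

/-- The inverse of `L_i`. -/
def Linv (i : Fin n) : FiniteDual k Q.A := Q.diag fun j => Q.κ j i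

/-- Two group-like elements of `A(R_Q)⁰` are equal if they agree on the generators. -/
theorem eq_of_comul {f g : FiniteDual k Q.A} (hf : comul (R := k) f = f ⊗ₜ[k] f)
    (hg : comul (R := k) g = g ⊗ₜ[k] g) (hf1 : f 1 = 1) (hg1 : g 1 = 1)
    (h : ∀ i j, f (Q.T i j) = g (Q.T i j)) : f = g := by
  have hfm : ∀ x y, f (x * y) = f x * f y := fun x y => by
    rw [← FiniteDual.ev₂_comul, hf, FiniteDual.ev₂_tmul]
  have hgm : ∀ x y, g (x * y) = g x * g y := fun x y => by
    rw [← FiniteDual.ev₂_comul, hg, FiniteDual.ev₂_tmul]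
  have h2 : AlgHom.ofLinearMap f.toDual hf1 hfm = AlgHom.ofLinearMap g.toDual hg1 hgm :=
    FRTAlgebra.algHom_ext h
  exact FiniteDual.ext fun x => DFunLike.congr_fun h2 x

theorem diag_one (c : Fin n → k) : Q.diag c 1 = 1 :=
  map_one (FRTAlgebra.lift _ (Q.rtt_diag c))

theorem diag_mul (c d : Fin n → k) : Q.diag c * Q.diag d = Q.diag (fun i => c i * d i) := by
  refine Q.eq_of_comul ?_ (Q.comul_diag _) ?_ (Q.diag_one _) fun i j => ?_
  · rw [Bialgebra.comul_mul, comul_diag, comul_diag, Algebra.TensorProduct.tmul_mul_tmul]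
  · rw [← FiniteDual.counit_apply, Bialgebra.counit_mul, FiniteDual.counit_apply,
      FiniteDual.counit_apply, diag_one, diag_one, mul_one]
  · refine (FiniteDual.mul_apply_T _ _ i j).trans ?_
    change ∑ m, Q.diag c (Q.T i m) * Q.diag d (Q.T m j) = _
    simp only [diag_T]
    rw [Finset.sum_eq_single i (fun m _ hm => by rw [if_neg hm.symm, zero_mul]) (by simp),
      if_pos rfl, mul_ite, mul_zero]

theorem diag_const_one : Q.diag (fun _ => 1) = 1 := by
  refine Q.eq_of_comul (Q.comul_diag _) (Bialgebra.comul_one) (Q.diag_one _)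
    (by rw [FiniteDual.one_apply, Bialgebra.counit_one]) fun i j => ?_
  rw [diag_T, FiniteDual.one_apply]
  exact (FRTAlgebra.counit_T Q.R i j).symm

theorem K_mul_Kinv (i : Fin n) : Q.K i * Q.Kinv i = 1 := by
  rw [K, Kinv, diag_mul, ← diag_const_one]
  simp only [mul_inv_cancel₀ (Q.κ_ne_zero _ _)]

theorem Kinv_mul_K (i : Fin n) : Q.Kinv i * Q.K i = 1 := by
  rw [K, Kinv, diag_mul, ← diag_const_one]
  simp only [inv_mul_cancel₀ (Q.κ_ne_zero _ _)]

theorem L_mul_Linv (i : Fin n) : Q.L i * Q.Linv i = 1 := by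
  rw [L, Linv, diag_mul, ← diag_const_one]
  simp only [inv_mul_cancel₀ (Q.κ_ne_zero _ _)]

theorem Linv_mul_L (i : Fin n) : Q.Linv i * Q.L i = 1 := by
  rw [L, Linv, diag_mul, ← diag_const_one]
  simp only [mul_inv_cancel₀ (Q.κ_ne_zero _ _)]

theorem lam_T_T (i j a b : Fin n) : Q.lam (Q.T i j) (Q.T a b) =
    if i = j then (if a = b then Q.κ i a else 0)
    else if j < i ∧ a = j ∧ b = i then Q.r - 1 else 0 := by
  rw [lam_apply, form_T_T, R]
  by_cases h : i = j
  · subst h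
    by_cases h2 : a = b
    · simp [h2]
    · simp only [h2, if_true, if_false, true_and]
      rw [if_neg]
      rintro ⟨h3, h4, h5⟩
      exact h2 (h4.trans h3)
  · simp only [h, if_false, false_and]
    congr 1
    apply propext
    constructor
    · rintro ⟨h3, h4, h5⟩
      exact ⟨h4 ▸ h5, h4, h3.symm⟩
    · rintro ⟨h3, h4, h5⟩
      exact ⟨h5.symm, h4, h4 ▸ h3⟩

theorem rho_T_T (i j a b : Fin n) : Q.rho (Q.T i j) (Q.T a b) =
    if i = j then (if a = b then Q.κ a i else 0)
    else if i < j ∧ a = j ∧ b = i then Q.r - 1 else 0 := by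
  rw [rho_apply, form_T_T, R]
  by_cases h : i = j
  · subst h
    by_cases h2 : a = b
    · simp [h2]
    · simp only [h2, if_true, if_false, false_and]
      rw [if_neg]
      rintro ⟨h3, h4, h5⟩
      exact h2 (h3.trans h4)
  · simp only [h, if_false, and_false]
    congr 1
    apply propext
    constructor
    · rintro ⟨h3, h4, h5⟩
      exact ⟨h3 ▸ h5, h3, h4.symm⟩
    · rintro ⟨h3, h4, h5⟩
      exact ⟨h4, h5.symm, h4 ▸ h3⟩

theorem lower_triangular (φ : Q.A →ₐ[k] Matrix (Fin n) (Fin n) k)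
    (h : ∀ a b i j, i < j → φ (Q.T a b) i j = 0) (x : Q.A) {i j : Fin n} (hij : i < j) :
    φ x i j = 0 := by
  let S : Subalgebra k Q.A :=
    { carrier := {x | ∀ i j, i < j → φ x i j = 0}
      mul_mem' := by
        intro x y hx hy i j hij
        rw [map_mul, Matrix.mul_apply]
        refine Finset.sum_eq_zero fun m _ => ?_
        rcases lt_or_ge i m with h | h
        · rw [hx i m h, zero_mul]
        · rw [hy m j (h.trans_lt hij), mul_zero]
      add_mem' := by
        intro x y hx hy i j hij
        rw [map_add, Matrix.add_apply, hx i j hij, hy i j hij, add_zero]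
      algebraMap_mem' := by
        intro c i j hij
        rw [AlgHom.commutes, Matrix.algebraMap_matrix_apply, if_neg hij.ne] }
  exact FRTAlgebra.mem_of_T S (fun a b => h a b) x i j hij

theorem lam_T_apply (i j : Fin n) (x : Q.A) :
    Q.lam (Q.T i j) x = genRep Q.yangBaxter x i j := by
  have h : Q.lam (Q.T i j) = genFun Q.yangBaxter i j := lambdaPlus_T Q.yangBaxter i j
  rw [h]
  rfl

theorem rho_T_apply (i j : Fin n) (x : Q.A) :
    Q.rho (Q.T i j) x = genRep' Q.yangBaxter x j i := rfl

theorem lam_T_of_lt {i j : Fin n} (h : i < j) : Q.lam (Q.T i j) = 0 := by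
  refine FiniteDual.ext fun x => ?_
  rw [lam_T_apply]
  refine Q.lower_triangular _ (fun a b i j hij => ?_) x h
  rw [← lam_T_apply, lam_T_T, if_neg hij.ne, if_neg (fun h => hij.not_gt h.1)]

theorem rho_T_of_gt {i j : Fin n} (h : j < i) : Q.rho (Q.T i j) = 0 := by
  refine FiniteDual.ext fun x => ?_
  rw [rho_T_apply]
  refine Q.lower_triangular _ (fun a b i j hij => ?_) x h
  rw [← rho_T_apply, rho_T_T, if_neg hij.ne', if_neg (fun h => hij.not_gt h.1)]

theorem comul_lam_T (i j : Fin n) : comul (R := k) (Q.lam (Q.T i j)) =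
    ∑ m, Q.lam (Q.T i m) ⊗ₜ[k] Q.lam (Q.T m j) := by
  have h : ∀ i j, Q.lam (Q.T i j) = genFun Q.yangBaxter i j :=
    fun i j => lambdaPlus_T Q.yangBaxter i j
  simp only [h, comul_genFun]

theorem comul_rho_T (i j : Fin n) : comul (R := k) (Q.rho (Q.T i j)) =
    ∑ m, Q.rho (Q.T m j) ⊗ₜ[k] Q.rho (Q.T i m) :=
  comul_rhoPlus_T Q.yangBaxter i j

theorem lam_T_self (i : Fin n) : Q.lam (Q.T i i) = Q.K i := by
  refine Q.eq_of_comul ?_ (Q.comul_diag _) ?_ (Q.diag_one _) fun a b => ?_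
  · rw [comul_lam_T]
    refine Finset.sum_eq_single i (fun m _ hm => ?_) (by simp)
    rcases lt_or_gt_of_ne hm with h | h
    · rw [Q.lam_T_of_lt h, TensorProduct.tmul_zero]
    · rw [Q.lam_T_of_lt h, TensorProduct.zero_tmul]
  · rw [lam_T_apply, map_one, Matrix.one_apply_eq]
  · rw [lam_T_T, K, diag_T, if_pos rfl]

theorem rho_T_self (i : Fin n) : Q.rho (Q.T i i) = Q.Linv i := by
  refine Q.eq_of_comul ?_ (Q.comul_diag _) ?_ (Q.diag_one _) fun a b => ?_
  · rw [comul_rho_T]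
    refine Finset.sum_eq_single i (fun m _ hm => ?_) (by simp)
    rcases lt_or_gt_of_ne hm with h | h
    · rw [Q.rho_T_of_gt h, TensorProduct.tmul_zero]
    · rw [Q.rho_T_of_gt h, TensorProduct.zero_tmul]
  · rw [rho_T_apply, map_one, Matrix.one_apply_eq]
  · rw [rho_T_T, Linv, diag_T, if_pos rfl]

/-- `E i j`, for `j = i + 1`, is the skew-primitive element `E_{i+1}^i` of `A(R_Q)⁰` with
`E_{i+1}^i(T_a^b) = δ_{a,i} δ_{b,i+1}`. -/
def E (i j : Fin n) : FiniteDual k Q.A := (Q.r - 1)⁻¹ • Q.lam (Q.T j i)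

/-- `F i j`, for `j = i + 1`, is the skew-primitive element `F_i^{i+1}` of `A(R_Q)⁰` with
`F_i^{i+1}(T_a^b) = δ_{a,i+1} δ_{b,i}`. -/
def F (i j : Fin n) : FiniteDual k Q.A :=
  (Q.r ^ 2 * (Q.r - 1)⁻¹) • (Q.L j * Q.rho (Q.T i j) * Q.L i)

theorem E_T {i j : Fin n} (h : i < j) (a b : Fin n) :
    Q.E i j (Q.T a b) = if a = i ∧ b = j then 1 else 0 := by
  have h1 : Q.r - 1 ≠ 0 := sub_ne_zero.2 Q.r_ne_one
  rw [E, FiniteDual.smul_apply, lam_T_T, if_neg h.ne']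
  simp only [h, true_and]
  split_ifs
  · exact inv_mul_cancel₀ h1
  · exact mul_zero _

theorem F_T {i j : Fin n} (h : i < j) (a b : Fin n) :
    Q.F i j (Q.T a b) = if a = j ∧ b = i then 1 else 0 := by
  have h1 : Q.r - 1 ≠ 0 := sub_ne_zero.2 Q.r_ne_one
  have h0 := Q.r_ne_zero
  have hL : ∀ (c d : Fin n → k) (f : FiniteDual k Q.A),
      (Q.diag c * f * Q.diag d) (Q.T a b) = c a * f (Q.T a b) * d b := by
    intro c d f
    refine (FiniteDual.mul_apply_T _ _ a b).trans ?_
    have h2 : ∀ m, (Q.diag c * f) (FRTAlgebra.T Q.R a m) = c a * f (Q.T a m) := by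
      intro m
      refine (FiniteDual.mul_apply_T _ _ a m).trans ?_
      change ∑ l, Q.diag c (Q.T a l) * f (Q.T l m) = _
      simp only [diag_T, ite_mul, zero_mul, Finset.sum_ite_eq, Finset.mem_univ, if_true]
    change ∑ m, (Q.diag c * f) (FRTAlgebra.T Q.R a m) * Q.diag d (Q.T m b) = _
    simp only [h2, diag_T, mul_ite, mul_zero, Finset.sum_ite_eq', Finset.mem_univ, if_true]
  rw [F, FiniteDual.smul_apply, L, L, hL, rho_T_T, if_neg h.ne]
  simp only [h, true_and]
  split_ifs with h2
  · rw [h2.1, h2.2, κ_self, κ_self]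
    field_simp
  · simp

/-- `j` is the successor of `i`. -/
def Adj (i j : Fin n) : Prop := (i : ℕ) + 1 = j

theorem Adj.lt {i j : Fin n} (h : Adj i j) : i < j := by
  unfold Adj at h
  exact Fin.lt_def.2 (by omega)

theorem Adj.between {i j : Fin n} (h : Adj i j) {m : Fin n} (h1 : m ≠ i) (h2 : m ≠ j) :
    m < i ∨ j < m := by
  unfold Adj at h
  rw [Fin.lt_def, Fin.lt_def]
  have h3 : (m : ℕ) ≠ i := fun h => h1 (Fin.ext h)
  have h4 : (m : ℕ) ≠ j := fun h => h2 (Fin.ext h)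
  omega

theorem comul_E {i j : Fin n} (h : Adj i j) : comul (R := k) (Q.E i j) =
    Q.K j ⊗ₜ[k] Q.E i j + Q.E i j ⊗ₜ[k] Q.K i := by
  have h2 : comul (R := k) (Q.lam (Q.T j i)) =
      Q.K j ⊗ₜ[k] Q.lam (Q.T j i) + Q.lam (Q.T j i) ⊗ₜ[k] Q.K i := by
    rw [comul_lam_T, ← lam_T_self, ← lam_T_self]
    refine Finset.sum_eq_add j i h.lt.ne' (fun m _ hm => ?_) (by simp) (by simp)
    rcases h.between hm.2 hm.1 with h' | h'
    · rw [Q.lam_T_of_lt h', TensorProduct.tmul_zero]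
    · rw [Q.lam_T_of_lt h', TensorProduct.zero_tmul]
  rw [E, map_smul, h2, smul_add, TensorProduct.tmul_smul, ← TensorProduct.smul_tmul']

theorem comul_F {i j : Fin n} (h : Adj i j) : comul (R := k) (Q.F i j) =
    Q.L i ⊗ₜ[k] Q.F i j + Q.F i j ⊗ₜ[k] Q.L j := by
  have h2 : comul (R := k) (Q.rho (Q.T i j)) =
      Q.rho (Q.T i j) ⊗ₜ[k] Q.Linv i + Q.Linv j ⊗ₜ[k] Q.rho (Q.T i j) := by
    rw [comul_rho_T, ← rho_T_self, ← rho_T_self]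
    refine Finset.sum_eq_add i j h.lt.ne (fun m _ hm => ?_) (by simp) (by simp)
    rcases h.between hm.1 hm.2 with h' | h'
    · rw [Q.rho_T_of_gt h', TensorProduct.tmul_zero]
    · rw [Q.rho_T_of_gt h', TensorProduct.zero_tmul]
  have h3 : ∀ i, comul (R := k) (Q.L i) = Q.L i ⊗ₜ[k] Q.L i := fun i => Q.comul_diag _
  rw [F, map_smul, Bialgebra.comul_mul, Bialgebra.comul_mul, h2, h3, h3, mul_add, add_mul]
  simp only [Algebra.TensorProduct.tmul_mul_tmul, L_mul_Linv, mul_assoc, Linv_mul_L, one_mul,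
    mul_one]
  rw [smul_add, TensorProduct.tmul_smul, ← TensorProduct.smul_tmul', add_comm]

/-- `B^l`, the subalgebra of `U_Q ⊆ A(R_Q)⁰` generated by `K_i`, `K_i⁻¹` and the `E_{i+1}^i`. -/
def Bl : Subalgebra k (FiniteDual k Q.A) :=
  Algebra.adjoin k (Set.range Q.K ∪ Set.range Q.Kinv ∪ {x | ∃ i j, Adj i j ∧ x = Q.E i j})

/-- `B^r`, the subalgebra of `U_Q ⊆ A(R_Q)⁰` generated by `L_i`, `L_i⁻¹` and the `F_i^{i+1}`. -/
def Br : Subalgebra k (FiniteDual k Q.A) :=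
  Algebra.adjoin k (Set.range Q.L ∪ Set.range Q.Linv ∪ {x | ∃ i j, Adj i j ∧ x = Q.F i j})

theorem comul_mem_adjoin {H : Type*} [Ring H] [Bialgebra k H] (s : Set H)
    (hs : ∀ x ∈ s, comul (R := k) x ∈ (subTensor k (Algebra.adjoin k s)).range) :
    ∀ x ∈ Algebra.adjoin k s, comul (R := k) x ∈ (subTensor k (Algebra.adjoin k s)).range := by
  have h : Algebra.adjoin k s ≤
      (subTensor k (Algebra.adjoin k s)).range.comap (Bialgebra.comulAlgHom k H) :=
    Algebra.adjoin_le hs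
  exact h

theorem tmul_mem {H : Type*} [Ring H] [Bialgebra k H] (S : Subalgebra k H) {x y : H}
    (hx : x ∈ S) (hy : y ∈ S) : x ⊗ₜ[k] y ∈ (subTensor k S).range :=
  ⟨(⟨x, hx⟩ : S) ⊗ₜ[k] (⟨y, hy⟩ : S), rfl⟩

theorem comul_mem_Bl : ∀ x ∈ Q.Bl, comul (R := k) x ∈ (subTensor k Q.Bl).range := by
  refine comul_mem_adjoin _ ?_
  have hK : ∀ i, Q.K i ∈ Q.Bl := fun i => Algebra.subset_adjoin (Or.inl (Or.inl ⟨i, rfl⟩))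
  rintro x ((⟨i, rfl⟩ | ⟨i, rfl⟩) | ⟨i, j, h, rfl⟩)
  · rw [K, comul_diag]
    exact tmul_mem _ (hK i) (hK i)
  · rw [Kinv, comul_diag]
    have h : Q.Kinv i ∈ Q.Bl := Algebra.subset_adjoin (Or.inl (Or.inr ⟨i, rfl⟩))
    exact tmul_mem _ h h
  · rw [Q.comul_E h]
    have h : Q.E i j ∈ Q.Bl := Algebra.subset_adjoin (Or.inr ⟨i, j, h, rfl⟩)
    exact add_mem (tmul_mem _ (hK j) h) (tmul_mem _ h (hK i))

theorem comul_mem_Br : ∀ x ∈ Q.Br, comul (R := k) x ∈ (subTensor k Q.Br).range := by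
  refine comul_mem_adjoin _ ?_
  have hL : ∀ i, Q.L i ∈ Q.Br := fun i => Algebra.subset_adjoin (Or.inl (Or.inl ⟨i, rfl⟩))
  rintro x ((⟨i, rfl⟩ | ⟨i, rfl⟩) | ⟨i, j, h, rfl⟩)
  · rw [L, comul_diag]
    exact tmul_mem _ (hL i) (hL i)
  · rw [Linv, comul_diag]
    have h : Q.Linv i ∈ Q.Br := Algebra.subset_adjoin (Or.inl (Or.inr ⟨i, rfl⟩))
    exact tmul_mem _ h h
  · rw [Q.comul_F h]
    have h : Q.F i j ∈ Q.Br := Algebra.subset_adjoin (Or.inr ⟨i, j, h, rfl⟩)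
    exact add_mem (tmul_mem _ (hL i) h) (tmul_mem _ h (hL j))

/-- The bialgebra structure of `B^l`, restricted from `A(R_Q)⁰`. -/
instance : Bialgebra k Q.Bl := subBialgebra Q.Bl Q.comul_mem_Bl

/-- The bialgebra structure of `B^r`, restricted from `A(R_Q)⁰`. -/
instance : Bialgebra k Q.Br := subBialgebra Q.Br Q.comul_mem_Br

end Multiparameter

end QHopf

end

noncomputable section

namespace QHopf

open scoped TensorProduct

/-! ## Antipodes of bialgebras generated by group-like and skew-primitive elements -/

section Antipode

variable {k : Type*} [Field k] {H : Type*} [Ring H] [Bialgebra k H]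

open Coalgebra WithConv

/-! The algebras $B^l$ and $B^r$ are generated by invertible group-like and by skew-primitive
elements, and this alone forces an antipode. Filter such a bialgebra so that $\Delta(F_m)\subseteq
kG\otimes F_m+H\otimes F_{m-1}$, where $G$ is the set of invertible group-likes. A convolution
operator that vanishes on $G$ is then locally nilpotent, so an operator that takes the value $1$ on
$G$ is convolution invertible. Apply this to $\mathrm{id}*S_0$ and $S_0*\mathrm{id}$, where $S_0$ is
any linear map inverting the elements of $G$ (`exists_isAntipode`). The same argument applies to
$(B^l)^{\mathrm{cop}}$, and the transpose of its antipode is an antipode of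
$(B^l)^{0\,\mathrm{cop}}$ (`exists_isAntipode_cop_finiteDual`).

The FRT relations write $T_i^l$, up to the factor $T_m^m$ with $m$ strictly between $i$ and $l$,
through generators with closer indices. Since $K_m$ and $L_m$ are invertible, induction on the
distance puts the images of $\lambda^+$ and $\rho^+$ in $B^l$ and $B^r$.

The map $\theta$ is obtained by inverting a restriction. Each $b\in A$ gives the functional
$x\mapsto x(b)$ on $B^l$ (`evBl`), and restricting functionals along $\lambda^+$ (`restrictLam`)
sends it to $\rho^+(b)$. The functional of $T_i^i$ is group-like, hence invertible in the Hopf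
algebra $(B^l)^{0\,\mathrm{cop}}$, and the restriction of its inverse is $L_i$. So restriction maps
the algebra $D$ generated by these evaluations and inverses onto $B^r$.

Injectivity on $D$ is the main point, because $\lambda^+(A)$ supplies only the $K_i$ and
$E_{i+1}^i$, not the $K_i^{-1}$. Let $B^l$ act on its finite dual by $(y\cdot f)(x)=f(xy)$, and let
$W\subseteq D$ consist of the functionals that vanish on $\lambda^+(A)$. The elements $K_i$ and
$E_{i+1}^i$ preserve $W$, as $\lambda^+(A)$ is closed under products. Moreover $D$ is spanned by
eigenvectors of $K_i$ with nonzero eigenvalues, so on each vector $K_i^{-1}$ acts as a polynomial in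
$K_i$ and preserves $W$ too. Thus $B^l\cdot W\subseteq W$, and $f(y)=(y\cdot f)(1)=0$ for $f\in W$
(`eq_zero_of_restrictLam_eq_zero`). The inverse of $D\cong B^r$ is $\theta$. It respects
comultiplications on generators, the co-opposite accounting for the reversed coproduct of
$\rho^+(T_i^j)$, and every bialgebra map commutes with antipodes. -/

theorem isAntipode_iff {S : H →ₗ[k] H} : IsAntipode S ↔
    toConv S * toConv LinearMap.id = 1 ∧ toConv LinearMap.id * toConv S = 1 := by
  rw [← (WithConv.equiv _).injective.eq_iff, ← (WithConv.equiv _).injective.eq_iff]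
  rfl

variable (k H)

/-- The invertible group-like elements. -/
def unitGroupLikes : Set H := {g | IsGroupLikeElem k g ∧ IsUnit g}

/-- The elements `x` with `Δ(x) = g ⊗ x + x ⊗ h` for invertible group-like `g`, `h`. -/
def skewPrimitives : Set H :=
  {x | ∃ g ∈ unitGroupLikes k H, ∃ h ∈ unitGroupLikes k H,
    comul (R := k) x = g ⊗ₜ[k] x + x ⊗ₜ[k] h}

variable {H} in
/-- The span of the tensors `x ⊗ y` with `x ∈ p` and `y ∈ q`. -/
def tensorSpan (p q : Submodule k H) : Submodule k (H ⊗[k] H) :=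
  Submodule.map₂ (TensorProduct.mk k H H) p q

/-- A filtration whose union contains every product of invertible group-like and skew-primitive
elements. -/
def skewFiltration : ℕ → Submodule k H
  | 0 => ⊥
  | m + 1 => Submodule.span k (unitGroupLikes k H) ⊔
      Submodule.span k (unitGroupLikes k H ∪ skewPrimitives k H) * skewFiltration m

variable {k H}

theorem one_mem_unitGroupLikes : (1 : H) ∈ unitGroupLikes k H :=
  ⟨.one, isUnit_one⟩

theorem mul_mem_unitGroupLikes {g h : H} (hg : g ∈ unitGroupLikes k H)
    (hh : h ∈ unitGroupLikes k H) : g * h ∈ unitGroupLikes k H :=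
  ⟨hg.1.mul hh.1, hg.2.mul hh.2⟩

/-- Multiplying $\Delta(x)=a\otimes x+x\otimes b$ by $g\otimes g$ replaces $a,b$ by $ga,gb$. This is
what lets group-likes act on the filtration without raising its index. -/
theorem mul_mem_skewPrimitives {g x : H} (hg : g ∈ unitGroupLikes k H)
    (hx : x ∈ skewPrimitives k H) : g * x ∈ skewPrimitives k H := by
  obtain ⟨a, ha, b, hb, h⟩ := hx
  refine ⟨g * a, mul_mem_unitGroupLikes hg ha, g * b, mul_mem_unitGroupLikes hg hb, ?_⟩
  rw [Bialgebra.comul_mul, h, hg.1.comul_eq_tmul_self, mul_add]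
  simp only [Algebra.TensorProduct.tmul_mul_tmul]

theorem mul_mem_tensorSpan {p q p' q' : Submodule k H} {a b : H} (ha : ∀ x ∈ p, a * x ∈ p')
    (hb : ∀ y ∈ q, b * y ∈ q') {t : H ⊗[k] H} (ht : t ∈ tensorSpan k p q) :
    a ⊗ₜ[k] b * t ∈ tensorSpan k p' q' := by
  have h : tensorSpan k p q ≤
      (tensorSpan k p' q').comap (LinearMap.mulLeft k (a ⊗ₜ[k] b)) := by
    refine Submodule.map₂_le.2 fun x hx y hy => ?_
    rw [Submodule.mem_comap, LinearMap.mulLeft_apply, TensorProduct.mk_apply,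
      Algebra.TensorProduct.tmul_mul_tmul]
    exact Submodule.apply_mem_map₂ _ (ha x hx) (hb y hy)
  exact h ht

theorem skewFiltration_le_succ (m : ℕ) : skewFiltration k H m ≤ skewFiltration k H (m + 1) := by
  induction m with
  | zero => exact bot_le
  | succ m ih => exact sup_le_sup_left (mul_le_mul' le_rfl ih) _

theorem skewFiltration_mono : Monotone (skewFiltration k H) :=
  monotone_nat_of_le_succ skewFiltration_le_succ

theorem span_unitGroupLikes_le (m : ℕ) :
    Submodule.span k (unitGroupLikes k H) ≤ skewFiltration k H (m + 1) := le_sup_left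

theorem mul_mem_skewFiltration_succ {w x : H} {m : ℕ}
    (hw : w ∈ unitGroupLikes k H ∪ skewPrimitives k H) (hx : x ∈ skewFiltration k H m) :
    w * x ∈ skewFiltration k H (m + 1) :=
  (le_sup_right : _ ≤ skewFiltration k H (m + 1))
    (Submodule.mul_mem_mul (Submodule.subset_span hw) hx)

theorem groupLike_mul_mem_span {g x : H} (hg : g ∈ unitGroupLikes k H)
    (hx : x ∈ Submodule.span k (unitGroupLikes k H)) :
    g * x ∈ Submodule.span k (unitGroupLikes k H) := by
  have h : Submodule.span k (unitGroupLikes k H) ≤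
      (Submodule.span k (unitGroupLikes k H)).comap (LinearMap.mulLeft k g) :=
    Submodule.span_le.2 fun y hy => Submodule.subset_span (mul_mem_unitGroupLikes hg hy)
  exact h hx

/-- A group-like factor is absorbed into the leftmost factor of a product, so the number of factors
stays the same. The estimate of $\Delta$ below would fail with an index shift here. -/
theorem groupLike_mul_mem_skewFiltration {g x : H} {m : ℕ} (hg : g ∈ unitGroupLikes k H)
    (hx : x ∈ skewFiltration k H m) : g * x ∈ skewFiltration k H m := by
  cases m with
  | zero =>
    rw [(Submodule.mem_bot k).1 hx, mul_zero]
    exact zero_mem _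
  | succ m =>
    have h : skewFiltration k H (m + 1) ≤
        (skewFiltration k H (m + 1)).comap (LinearMap.mulLeft k g) := by
      refine sup_le (fun y hy => span_unitGroupLikes_le m (groupLike_mul_mem_span hg hy)) ?_
      refine Submodule.mul_le.2 fun w hw y hy => ?_
      rw [Submodule.mem_comap, LinearMap.mulLeft_apply, ← mul_assoc]
      refine (le_sup_right : _ ≤ skewFiltration k H (m + 1)) (Submodule.mul_mem_mul ?_ hy)
      have h2 : Submodule.span k (unitGroupLikes k H ∪ skewPrimitives k H) ≤
          (Submodule.span k (unitGroupLikes k H ∪ skewPrimitives k H)).comap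
            (LinearMap.mulLeft k g) := by
        refine Submodule.span_le.2 fun y hy => Submodule.subset_span ?_
        rcases hy with hy | hy
        · exact Or.inl (mul_mem_unitGroupLikes hg hy)
        · exact Or.inr (mul_mem_skewPrimitives hg hy)
      exact h2 hw
    exact h hx

theorem mul_mem_skewFiltration_of_pred {w x : H} {m : ℕ}
    (hw : w ∈ unitGroupLikes k H ∪ skewPrimitives k H) (hx : x ∈ skewFiltration k H (m - 1)) :
    w * x ∈ skewFiltration k H m := by
  cases m with
  | zero =>
    rw [(Submodule.mem_bot k).1 hx, mul_zero]
    exact zero_mem _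
  | succ m => exact mul_mem_skewFiltration_succ hw hx

/-- Induction on the number of factors: the coproduct of one more factor multiplies both summands of
the bound, and each resulting term lands in the bound for $m+1$. Starting the filtration at $0$
makes the truncated index $m-1$ harmless when $m=0$. -/
theorem comul_mem_of_mem_skewFiltration (m : ℕ) : ∀ x ∈ skewFiltration k H m,
    comul (R := k) x ∈
      tensorSpan k (Submodule.span k (unitGroupLikes k H)) (skewFiltration k H m) ⊔
        tensorSpan k ⊤ (skewFiltration k H (m - 1)) := by
  induction m with
  | zero =>
    intro x hx
    rw [(Submodule.mem_bot k).1 hx, map_zero]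
    exact zero_mem _
  | succ m ih =>
    set N := tensorSpan k (Submodule.span k (unitGroupLikes k H)) (skewFiltration k H (m + 1)) ⊔
        tensorSpan k ⊤ (skewFiltration k H (m + 1 - 1)) with hN
    have h1 : ∀ {t}, t ∈ tensorSpan k (Submodule.span k (unitGroupLikes k H))
        (skewFiltration k H (m + 1)) → t ∈ N := fun h => (le_sup_left : _ ≤ N) h
    have h2 : ∀ {t}, t ∈ tensorSpan k ⊤ (skewFiltration k H m) → t ∈ N :=
      fun h => (le_sup_right : _ ≤ N) h
    have key : skewFiltration k H (m + 1) ≤ N.comap (comul (R := k)) := by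
      refine sup_le (Submodule.span_le.2 fun g hg => ?_) (Submodule.mul_le.2 fun w hw x hx => ?_)
      · change comul (R := k) g ∈ N
        rw [hg.1.comul_eq_tmul_self]
        exact h1 (Submodule.apply_mem_map₂ _ (Submodule.subset_span hg)
          (span_unitGroupLikes_le m (Submodule.subset_span hg)))
      · rw [Submodule.mem_comap]
        obtain ⟨t, ht, t', ht', htx⟩ := Submodule.mem_sup.1 (ih x hx)
        induction hw using Submodule.span_induction with
        | zero => simp
        | add y z _ _ hy hz => rw [add_mul, map_add]; exact add_mem hy hz
        | smul c y _ hy => rw [smul_mul_assoc, map_smul]; exact N.smul_mem c hy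
        | mem w hw =>
          rw [Bialgebra.comul_mul, ← htx]
          rcases hw with hw | ⟨g, hg, h, hh, hw'⟩
          · rw [hw.1.comul_eq_tmul_self, mul_add]
            refine add_mem (h1 ?_) (h2 ?_)
            · exact mul_mem_tensorSpan (fun y hy => groupLike_mul_mem_span hw hy)
                (fun y hy => mul_mem_skewFiltration_succ (Or.inl hw) hy) ht
            · exact mul_mem_tensorSpan (fun _ _ => Submodule.mem_top )
                (fun y hy => mul_mem_skewFiltration_of_pred (Or.inl hw) hy) ht'
          · have hw : w ∈ skewPrimitives k H := ⟨g, hg, h, hh, hw'⟩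
            -- Here $\Delta(w)=g\otimes w+w\otimes h$ meets $t\in kG\otimes F_m$ and $t'\in H\otimes
            -- F_{m-1}$. Only $(g\otimes w)t$ needs the first summand of the bound; the other three
            -- products have right leg in $F_m$, for $(w\otimes h)t$ because $hF_m\subseteq F_m$.
            rw [hw', add_mul, mul_add, mul_add]
            refine add_mem (add_mem (h1 ?_) (h2 ?_)) (add_mem (h2 ?_) (h2 ?_))
            · exact mul_mem_tensorSpan (fun y hy => groupLike_mul_mem_span hg hy)
                (fun y hy => mul_mem_skewFiltration_succ (Or.inr hw) hy) ht
            · exact mul_mem_tensorSpan (fun _ _ => Submodule.mem_top )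
                (fun y hy => mul_mem_skewFiltration_of_pred (Or.inr hw) hy) ht'
            · exact mul_mem_tensorSpan (fun _ _ => Submodule.mem_top )
                (fun y hy => groupLike_mul_mem_skewFiltration hh hy) ht
            · exact mul_mem_tensorSpan (fun _ _ => Submodule.mem_top )
                (fun y hy => mul_mem_skewFiltration_of_pred (Or.inl hh) hy) ht'
    exact fun x hx => key hx

/-- A bialgebra generated by invertible group-like and by skew-primitive elements is exhausted by
the skew-primitive filtration. -/
theorem exists_mem_skewFiltration {s : Set H} (hs : Algebra.adjoin k s = ⊤)
    (h : s ⊆ unitGroupLikes k H ∪ skewPrimitives k H) (x : H) : ∃ m, x ∈ skewFiltration k H m := by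
  have hx : x ∈ Subalgebra.toSubmodule (Algebra.adjoin k s) := by rw [hs]; trivial
  rw [Algebra.adjoin_eq_span] at hx
  induction hx using Submodule.span_induction with
  | zero => exact ⟨0, zero_mem _⟩
  | add y z _ _ hy hz =>
    obtain ⟨a, ha⟩ := hy
    obtain ⟨b, hb⟩ := hz
    exact ⟨max a b, add_mem (skewFiltration_mono (le_max_left a b) ha)
      (skewFiltration_mono (le_max_right a b) hb)⟩
  | smul c y _ hy =>
    obtain ⟨a, ha⟩ := hy
    exact ⟨a, Submodule.smul_mem _ c ha⟩
  | mem y hy =>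
    induction hy using Submonoid.closure_induction_left with
    | one => exact ⟨1, span_unitGroupLikes_le 0 (Submodule.subset_span one_mem_unitGroupLikes)⟩
    | mul_left w hw y _ hy =>
      obtain ⟨a, ha⟩ := hy
      exact ⟨a + 1, mul_mem_skewFiltration_succ (h hw) ha⟩

/-! ### Local nilpotency for the convolution product and the resulting antipode. -/

theorem convMul_apply_eq_zero {A : Type*} [Ring A] [Algebra k A] {p q : Submodule k H}
    {u v : WithConv (H →ₗ[k] A)}
    (hu : ∀ x ∈ p, u x = 0) (hv : ∀ x ∈ q, v x = 0) {p' q' : Submodule k H} {x : H}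
    (hx : comul (R := k) x ∈ tensorSpan k p q' ⊔ tensorSpan k p' q) : (u * v) x = 0 := by
  have h : tensorSpan k p q' ⊔ tensorSpan k p' q ≤
      LinearMap.ker (LinearMap.mul' k A ∘ₗ TensorProduct.map u.ofConv v.ofConv) := by
    refine sup_le (Submodule.map₂_le.2 fun a ha b _ => ?_) (Submodule.map₂_le.2 fun a _ b hb => ?_)
    · have := hu a ha
      change u.ofConv a * v.ofConv b = 0
      rw [show u.ofConv a = 0 from this, zero_mul]
    · have := hv b hb
      change u.ofConv a * v.ofConv b = 0
      rw [show v.ofConv b = 0 from this, mul_zero]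
  exact h hx

/-- In $u^{m+1}=u*u^m$ the factor $u$ kills the summand $kG\otimes F_{m+1}$ of the coproduct and, by
induction, $u^m$ kills $H\otimes F_m$. -/
theorem convPow_apply_eq_zero {A : Type*} [Ring A] [Algebra k A] {u : WithConv (H →ₗ[k] A)}
    (hu : ∀ g ∈ unitGroupLikes k H, u g = 0) (m : ℕ) :
    ∀ x ∈ skewFiltration k H m, (u ^ m) x = 0 := by
  have hu' : ∀ x ∈ Submodule.span k (unitGroupLikes k H), u x = 0 := by
    intro x hx
    have h : Submodule.span k (unitGroupLikes k H) ≤ LinearMap.ker u.ofConv :=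
      Submodule.span_le.2 hu
    exact h hx
  induction m with
  | zero =>
    intro x hx
    rw [(Submodule.mem_bot k).1 hx]
    exact map_zero _
  | succ m ih =>
    intro x hx
    rw [pow_succ']
    exact convMul_apply_eq_zero hu' ih (comul_mem_of_mem_skewFiltration (m + 1) x hx)

/-- If the powers of `u` vanish locally, then `1 - u` is invertible for the convolution. -/
theorem isUnit_one_sub_of_locally_nilpotent {A : Type*} [Ring A] [Algebra k A]
    {u : WithConv (H →ₗ[k] A)} (hu : ∀ x, ∃ m, ∀ i ≥ m, (u ^ i) x = 0) : IsUnit (1 - u) := by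
  have hfin : ∀ x, (Function.support fun i => (u ^ i) x).Finite := fun x => by
    obtain ⟨m, hm⟩ := hu x
    refine (Set.finite_lt_nat m).subset fun i hi => ?_
    by_contra h
    exact hi (hm i (not_lt.1 h))
  -- The geometric series $\sum_i u^i$, a finite sum at each vector.
  let T : WithConv (H →ₗ[k] A) := toConv
    { toFun := fun x => ∑ᶠ i, (u ^ i) x
      map_add' := fun x y => by
        rw [← finsum_add_distrib (hfin x) (hfin y)]
        exact finsum_congr fun i => map_add (u ^ i).ofConv x y
      map_smul' := fun c x => by
        rw [RingHom.id_apply, smul_finsum' c (hfin x)]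
        exact finsum_congr fun i => map_smul (u ^ i).ofConv c x }
  have hT : ∀ x m, (∀ i ≥ m, (u ^ i) x = 0) → ∀ M ≥ m, T x = (∑ i ∈ Finset.range M, u ^ i) x := by
    intro x m hm M hM
    have h1 : T x = ∑ i ∈ Finset.range M, (u ^ i) x := by
      refine finsum_eq_sum_of_support_subset _ fun i hi => ?_
      by_contra h
      exact hi (hm i (hM.trans (by simpa using h)))
    rw [h1]
    have h2 := congrArg (fun f => f x) (map_sum (WithConv.linearEquiv k (H →ₗ[k] A))
      (fun i => u ^ i) (Finset.range M))
    refine Eq.trans ?_ h2.symm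
    rw [LinearMap.sum_apply]
    rfl
  choose m hm using hu
  -- One truncation level $M$ that serves $x$ and all legs of a chosen expression of $\Delta(x)$. At
  -- $x$ the series may then be replaced by its partial sum, and the telescoping identity leaves
  -- $1-u^M$, which agrees with $1$ there.
  have key : ∀ x, ∃ M, m x ≤ M ∧ (∀ i ∈ (ℛ k x).index, m ((ℛ k x).left i) ≤ M) ∧
      (∀ i ∈ (ℛ k x).index, m ((ℛ k x).right i) ≤ M) := fun x => by
    refine ⟨m x + ∑ i ∈ (ℛ k x).index, (m ((ℛ k x).left i) + m ((ℛ k x).right i)), by omega,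
      fun i hi => ?_, fun i hi => ?_⟩ <;>
    · have := Finset.single_le_sum
        (f := fun i => m ((ℛ k x).left i) + m ((ℛ k x).right i)) (fun _ _ => Nat.zero_le _) hi
      omega
  have happ : ∀ x M, m x ≤ M → ((1 : WithConv (H →ₗ[k] A)) - u ^ M) x =
      (1 : WithConv (H →ₗ[k] A)) x := by
    intro x M hM
    change (1 : WithConv (H →ₗ[k] A)) x - (u ^ M) x = _
    rw [hm x M hM, sub_zero]
  refine isUnit_iff_exists.2 ⟨T, ?_, ?_⟩
  · refine WithConv.ext (LinearMap.ext fun x => ?_)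
    obtain ⟨M, hM, -, hr⟩ := key x
    refine Eq.trans ?_ (happ x M hM)
    change ((1 - u) * T) x = _
    rw [ ← mul_neg_geom_sum, (ℛ k x).convMul_apply, (ℛ k x).convMul_apply]
    exact Finset.sum_congr rfl fun i hi => by rw [hT _ _ (hm _) M (hr i hi)]
  · refine WithConv.ext (LinearMap.ext fun x => ?_)
    obtain ⟨M, hM, hl, -⟩ := key x
    refine Eq.trans ?_ (happ x M hM)
    change (T * (1 - u)) x = _
    rw [ ← geom_sum_mul_neg, (ℛ k x).convMul_apply, (ℛ k x).convMul_apply]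
    exact Finset.sum_congr rfl fun i hi => by rw [hT _ _ (hm _) M (hl i hi)]

/-- A bialgebra generated by invertible group-like and by skew-primitive elements has an
antipode. -/
theorem exists_isAntipode {s : Set H} (hs : Algebra.adjoin k s = ⊤)
    (h : s ⊆ unitGroupLikes k H ∪ skewPrimitives k H) : ∃ S : H →ₗ[k] H, IsAntipode S := by
  -- Group-like elements are linearly independent, so a linear map may be prescribed on them. Its
  -- values on the rest of the basis play no role.
  obtain ⟨S₀, hS₀⟩ : ∃ S₀ : H →ₗ[k] H, ∀ g ∈ unitGroupLikes k H, S₀ g = Ring.inverse g := by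
    have hli : LinearIndepOn k id {a : H | IsGroupLikeElem k a} := linearIndepOn_isGroupLikeElem
    let b := Module.Basis.extend hli
    refine ⟨b.constr k fun i => Ring.inverse (i : H), fun g hg => ?_⟩
    have h1 := b.constr_basis k (fun i => Ring.inverse (i : H))
      ⟨g, hli.subset_extend _ hg.1⟩
    rwa [Module.Basis.extend_apply_self] at h1
  -- The difference $1-v$ vanishes on invertible group-likes, hence is locally nilpotent.
  have hunit : ∀ v : WithConv (H →ₗ[k] H), (∀ g ∈ unitGroupLikes k H, v g = 1) → IsUnit v := by
    intro v hv
    rw [← sub_sub_cancel 1 v]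
    refine isUnit_one_sub_of_locally_nilpotent fun x => ?_
    obtain ⟨m, hm⟩ := exists_mem_skewFiltration hs h x
    refine ⟨m, fun i hi => convPow_apply_eq_zero (fun g hg => ?_) i x (skewFiltration_mono hi hm)⟩
    change (1 : WithConv (H →ₗ[k] H)) g - v g = 0
    rw [hv g hg, LinearMap.convOne_apply, hg.1.counit_eq_one, map_one, sub_self]
  have hmul : ∀ (u v : WithConv (H →ₗ[k] H)) (g : H), IsGroupLikeElem k g →
      (u * v) g = u g * v g := by
    intro u v g hg
    rw [LinearMap.convMul_apply, hg.comul_eq_tmul_self]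
    rfl
  have h1 : IsUnit (toConv LinearMap.id * toConv S₀ : WithConv (H →ₗ[k] H)) := by
    refine hunit _ fun g hg => ?_
    rw [hmul _ _ _ hg.1]
    change g * S₀ g = 1
    rw [hS₀ g hg, Ring.mul_inverse_cancel _ hg.2]
  have h2 : IsUnit (toConv S₀ * toConv LinearMap.id : WithConv (H →ₗ[k] H)) := by
    refine hunit _ fun g hg => ?_
    rw [hmul _ _ _ hg.1]
    change S₀ g * g = 1
    rw [hS₀ g hg, Ring.inverse_mul_cancel _ hg.2]
  -- Now $\mathrm{id}*(S_0*a)=1$ and $(b*S_0)*\mathrm{id}=1$, so the two one-sided inverses of the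
  -- identity coincide.
  obtain ⟨a, ha⟩ := h1.exists_right_inv
  obtain ⟨b, hb⟩ := h2.exists_left_inv
  rw [mul_assoc] at ha
  rw [← mul_assoc] at hb
  have hab := left_inv_eq_right_inv hb ha
  refine ⟨(toConv S₀ * a).ofConv, isAntipode_iff.2 ⟨?_, ha⟩⟩
  rw [← hab] at ha ⊢
  exact hb

end Antipode
end QHopf
end

noncomputable section

namespace QHopf

open scoped TensorProduct

/-! ## Antipodes of co-opposites and of finite duals -/

section AntipodeDual

variable {k : Type*} [Field k] {H : Type*} [Ring H] [Bialgebra k H]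

open Coalgebra WithConv

/-- The Hopf algebra structure given by an antipode. -/
@[reducible] def IsAntipode.hopfAlgebra {S : H →ₗ[k] H} (hS : IsAntipode S) : HopfAlgebra k H where
  antipode := S
  mul_antipode_rTensor_comul := hS.1
  mul_antipode_lTensor_comul := hS.2

theorem IsAntipode.map_mul {S : H →ₗ[k] H} (hS : IsAntipode S) (a b : H) :
    S (a * b) = S b * S a :=
  letI := hS.hopfAlgebra
  HopfAlgebra.antipode_mul_antidistrib (R := k) a b

theorem IsAntipode.map_one {S : H →ₗ[k] H} (hS : IsAntipode S) : S 1 = 1 :=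
  letI := hS.hopfAlgebra
  HopfAlgebra.antipode_one (R := k) (A := H)

theorem IsAntipode.sum_mul {S : H →ₗ[k] H} (hS : IsAntipode S) {ι : Type*} {x : H}
    (r : Coalgebra.Repr k x ι) :
    ∑ i ∈ r.index, r.left i * S (r.right i) = algebraMap k H (counit (R := k) x) :=
  letI := hS.hopfAlgebra
  HopfAlgebra.sum_mul_antipode_eq_algebraMap_counit r

theorem IsAntipode.sum_antipode_mul {S : H →ₗ[k] H} (hS : IsAntipode S) {ι : Type*} {x : H}
    (r : Coalgebra.Repr k x ι) :
    ∑ i ∈ r.index, S (r.left i) * r.right i = algebraMap k H (counit (R := k) x) :=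
  letI := hS.hopfAlgebra
  HopfAlgebra.sum_antipode_mul_eq_algebraMap_counit r

theorem IsAntipode.mul_groupLike {S : H →ₗ[k] H} (hS : IsAntipode S) {g : H}
    (hg : IsGroupLikeElem k g) : S g * g = 1 := by
  have h := LinearMap.congr_fun hS.1 g
  rw [LinearMap.comp_apply, LinearMap.comp_apply, LinearMap.comp_apply, hg.comul_eq_tmul_self,
    hg.counit_eq_one, LinearMap.rTensor_tmul, LinearMap.mul'_apply, Algebra.linearMap_apply,
    _root_.map_one] at h
  exact h

theorem IsAntipode.groupLike_mul {S : H →ₗ[k] H} (hS : IsAntipode S) {g : H}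
    (hg : IsGroupLikeElem k g) : g * S g = 1 := by
  have h := LinearMap.congr_fun hS.2 g
  rw [LinearMap.comp_apply, LinearMap.comp_apply, LinearMap.comp_apply, hg.comul_eq_tmul_self,
    hg.counit_eq_one, LinearMap.lTensor_tmul, LinearMap.mul'_apply, Algebra.linearMap_apply,
    _root_.map_one] at h
  exact h

/-- Both $\Delta(h)$ and $h\otimes h$ are inverse to $g\otimes g=\Delta(g)$. -/
theorem isGroupLikeElem_of_mul_eq_one {g h : H} (hg : IsGroupLikeElem k g) (h1 : g * h = 1)
    (h2 : h * g = 1) : IsGroupLikeElem k h where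
  counit_eq_one := by
    have := congrArg (counit (R := k)) h1
    rwa [Bialgebra.counit_mul, hg.counit_eq_one, one_mul, Bialgebra.counit_one] at this
  comul_eq_tmul_self := by
    have h3 : g ⊗ₜ[k] g * comul (R := k) h = 1 := by
      rw [← hg.comul_eq_tmul_self, ← Bialgebra.comul_mul, h1, Bialgebra.comul_one]
    have h4 : h ⊗ₜ[k] h * g ⊗ₜ[k] g = 1 := by
      rw [Algebra.TensorProduct.tmul_mul_tmul, h2, Algebra.TensorProduct.one_def]
    exact (left_inv_eq_right_inv h4 h3).symm

/-- A bialgebra map commutes with antipodes. -/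
theorem map_antipode {H' : Type*} [Ring H'] [Bialgebra k H'] {S : H →ₗ[k] H} {S' : H' →ₗ[k] H'}
    (hS : IsAntipode S) (hS' : IsAntipode S') (f : H →ₐc[k] H') (x : H) : f (S x) = S' (f x) := by
  let f' : H →ₐ[k] H' := f
  -- In the convolution algebra of maps $H\to H'$, $f\circ S$ is a left inverse of $f$ and $S'\circ
  -- f$ is a right inverse, so they are equal.
  have h1 : toConv (f'.toLinearMap ∘ₗ S) * toConv f'.toLinearMap = 1 := by
    have h := LinearMap.algHom_comp_convMul_distrib f' (toConv S) (toConv LinearMap.id)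
    rw [(isAntipode_iff.1 hS).1] at h
    apply WithConv.ext
    refine Eq.trans h.symm (LinearMap.ext fun y => ?_)
    exact f'.commutes _
  have h2 : toConv f'.toLinearMap * toConv (S' ∘ₗ f'.toLinearMap) = 1 := by
    have h := LinearMap.convMul_comp_coalgHom_distrib (toConv LinearMap.id) (toConv S')
      (f : H →ₗc[k] H')
    rw [(isAntipode_iff.1 hS').2] at h
    apply WithConv.ext
    refine Eq.trans h.symm (LinearMap.ext fun y => ?_)
    exact congrArg (algebraMap k H') (CoalgHomClass.counit_comp_apply f y)
  have h3 := left_inv_eq_right_inv h1 h2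
  exact LinearMap.congr_fun (congrArg WithConv.ofConv h3) x

theorem isGroupLikeElem_cop {g : H} (hg : IsGroupLikeElem k g) :
    IsGroupLikeElem k ((Cop.toBase k H).symm g) where
  counit_eq_one := hg.counit_eq_one
  comul_eq_tmul_self := by
    change TensorProduct.comm k H H (comul (R := k) g) = g ⊗ₜ g
    rw [hg.comul_eq_tmul_self, TensorProduct.comm_tmul]

/-- The co-opposite of a bialgebra generated by invertible group-like and by skew-primitive
elements has an antipode. -/
theorem exists_isAntipode_cop {s : Set H} (hs : Algebra.adjoin k s = ⊤)
    (h : s ⊆ unitGroupLikes k H ∪ skewPrimitives k H) : ∃ S : Cop H →ₗ[k] Cop H, IsAntipode S := by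
  have hg : ∀ g ∈ unitGroupLikes k H, (Cop.toBase k H).symm g ∈ unitGroupLikes k (Cop H) :=
    fun g hg => ⟨isGroupLikeElem_cop hg.1, hg.2.map (Cop.toBase k H).symm⟩
  refine exists_isAntipode (k := k) (H := Cop H) (s := s) hs fun x hx => ?_
  rcases h hx with hx | ⟨a, ha, b, hb, hx⟩
  · exact Or.inl (hg x hx)
  -- The flip exchanges the two group-likes attached to a skew-primitive element.
  · refine Or.inr ⟨_, hg b hb, _, hg a ha, ?_⟩
    refine (congrArg (TensorProduct.comm k H H) hx).trans ?_
    rw [map_add, add_comm]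
    rfl

/-- If $f$ factors through $H'/I$, its pullback factors through the opposite algebra of $H'/I$,
which is still finite-dimensional. -/
theorem vanishesOnCofiniteIdeal_comp_anti {H' : Type*} [Ring H'] [Bialgebra k H']
    (φ : H →ₐ[k] H'ᵐᵒᵖ) (f : FiniteDual k H') :
    VanishesOnCofiniteIdeal k H
      (f.toDual ∘ₗ (MulOpposite.opLinearEquiv k).symm.toLinearMap ∘ₗ φ.toLinearMap) := by
  obtain ⟨I, _, _, g, hg⟩ := VanishesOnCofiniteIdeal.exists_factor f.2
  have : Module.Finite k (H' ⧸ I)ᵐᵒᵖ := Module.Finite.equiv (MulOpposite.opLinearEquiv k)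
  refine VanishesOnCofiniteIdeal.of_factor (F := (H' ⧸ I)ᵐᵒᵖ)
    ((Ideal.Quotient.mkₐ k I).op.comp φ)
    (g ∘ₗ (MulOpposite.opLinearEquiv k).symm.toLinearMap) fun x => ?_
  exact hg _

/-- The transpose of an anti-algebra map. -/
def FiniteDual.compAnti {H' : Type*} [Ring H'] [Bialgebra k H'] (φ : H →ₐ[k] H'ᵐᵒᵖ) :
    FiniteDual k H' →ₗ[k] FiniteDual k H where
  toFun f := .mk _ (vanishesOnCofiniteIdeal_comp_anti φ f)
  map_add' _ _ := rfl
  map_smul' _ _ := rfl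

theorem FiniteDual.mul_apply_repr (f g : FiniteDual k H) {ι : Type*} {x : H}
    (r : Coalgebra.Repr k x ι) :
    (f * g) x = ∑ i ∈ r.index, f (r.left i) * g (r.right i) :=
  r.convMul_apply f.1 g.1

/-- If `H^cop` has an antipode, then so has `H⁰^cop`. -/
theorem exists_isAntipode_cop_finiteDual {S : Cop H →ₗ[k] Cop H} (hS : IsAntipode S) :
    ∃ S₀ : Cop (FiniteDual k H) →ₗ[k] Cop (FiniteDual k H), IsAntipode S₀ := by
  let S₁ : H →ₗ[k] H := S
  -- An antipode reverses products, so its transpose preserves the finite dual.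
  let φ : H →ₐ[k] Hᵐᵒᵖ := AlgHom.ofLinearMap
    ((MulOpposite.opLinearEquiv k).toLinearMap ∘ₗ S₁)
    (congrArg MulOpposite.op hS.map_one) (fun a b => congrArg MulOpposite.op (hS.map_mul a b))
  let S₀ : FiniteDual k H →ₗ[k] FiniteDual k H := FiniteDual.compAnti φ
  let r (x : H) : Coalgebra.Repr k (A := Cop H) x (H × H) :=
    { index := (ℛ k x).index
      left := (ℛ k x).right
      right := (ℛ k x).left
      eq := by
        change _ = TensorProduct.comm k H H (comul (R := k) x)
        conv_rhs => rw [← (ℛ k x).eq, map_sum]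
        rfl }
  refine ⟨S₀, LinearMap.ext fun f => FiniteDual.ext fun x => ?_,
    LinearMap.ext fun f => FiniteDual.ext fun x => ?_⟩
  -- With both coproducts flipped, the value of $S_0(f_2)*f_1$ at $x$ is $\sum f(x_2S(x_1))$, and
  -- $\sum x_2S(x_1)=\varepsilon(x)1$ is the antipode identity of $H^{\mathrm{cop}}$. The other
  -- identity is symmetric.
  · have h1 : ∀ t : FiniteDual k H ⊗[k] FiniteDual k H,
        (LinearMap.mul' k (FiniteDual k H) (S₀.rTensor _ (TensorProduct.comm k _ _ t))) x =
        ∑ i ∈ (ℛ k x).index, FiniteDual.ev₂ ((ℛ k x).right i) (S₁ ((ℛ k x).left i)) t := by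
      intro t
      induction t with
      | zero => simp only [map_zero, Finset.sum_const_zero]; rfl
      | add u v hu hv => simp only [map_add, FiniteDual.add_apply, hu, hv, Finset.sum_add_distrib]
      | tmul a b =>
        rw [TensorProduct.comm_tmul, LinearMap.rTensor_tmul, LinearMap.mul'_apply,
          FiniteDual.mul_apply_repr _ _ (ℛ k x)]
        exact Finset.sum_congr rfl fun i _ => mul_comm _ _
    refine (h1 (comul (R := k) (A := FiniteDual k H) f)).trans ?_
    refine (Finset.sum_congr rfl fun i _ => FiniteDual.ev₂_comul (H := H) f _ _).trans ?_
    refine (map_sum (FiniteDual.toDual (H := H) f) _ _).symm.trans ?_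
    have h2 : ∑ i ∈ (ℛ k x).index, (ℛ k x).right i * S₁ ((ℛ k x).left i) =
      algebraMap k H (counit (R := k) x) := hS.sum_mul (r x)
    refine (congrArg (FiniteDual.toDual (H := H) f) h2).trans ?_
    rw [Algebra.algebraMap_eq_smul_one, map_smul]
    exact mul_comm _ _
  · have h1 : ∀ t : FiniteDual k H ⊗[k] FiniteDual k H,
        (LinearMap.mul' k (FiniteDual k H) (S₀.lTensor _ (TensorProduct.comm k _ _ t))) x =
        ∑ i ∈ (ℛ k x).index, FiniteDual.ev₂ (S₁ ((ℛ k x).right i)) ((ℛ k x).left i) t := by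
      intro t
      induction t with
      | zero => simp only [map_zero, Finset.sum_const_zero]; rfl
      | add u v hu hv => simp only [map_add, FiniteDual.add_apply, hu, hv, Finset.sum_add_distrib]
      | tmul a b =>
        rw [TensorProduct.comm_tmul, LinearMap.lTensor_tmul, LinearMap.mul'_apply,
          FiniteDual.mul_apply_repr _ _ (ℛ k x)]
        exact Finset.sum_congr rfl fun i _ => mul_comm _ _
    refine (h1 (comul (R := k) (A := FiniteDual k H) f)).trans ?_
    refine (Finset.sum_congr rfl fun i _ => FiniteDual.ev₂_comul (H := H) f _ _).trans ?_
    refine (map_sum (FiniteDual.toDual (H := H) f) _ _).symm.trans ?_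
    have h2 : ∑ i ∈ (ℛ k x).index, S₁ ((ℛ k x).right i) * (ℛ k x).left i =
      algebraMap k H (counit (R := k) x) := hS.sum_antipode_mul (r x)
    refine (congrArg (FiniteDual.toDual (H := H) f) h2).trans ?_
    rw [Algebra.algebraMap_eq_smul_one, map_smul]
    exact mul_comm _ _

end AntipodeDual
end QHopf
end

noncomputable section

namespace QHopf

open scoped TensorProduct

namespace Multiparameter

variable {k : Type*} [Field k] {n : ℕ} (Q : Multiparameter k n)

open Coalgebra

/-! ## The images of `λ⁺` and `ρ⁺` -/

theorem lam_one : Q.lam 1 = 1 := lambdaPlus_one _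

theorem lam_mul (a b : Q.A) : Q.lam (a * b) = Q.lam b * Q.lam a := lambdaPlus_mul _ a b

theorem rho_one : Q.rho 1 = 1 := FiniteDual.ext fun a => braiding_one_right _ a

theorem rho_mul (a b : Q.A) : Q.rho (a * b) = Q.rho a * Q.rho b :=
  FiniteDual.ext fun x => braiding_mul_right _ x a b

/-- Each row and column of $R_Q$ has only a swap term and a diagonal term, so the double sums in the
FRT relation collapse. -/
theorem rtt_T (i j c d : Fin n) :
    Q.κ i j • (Q.T j c * Q.T i d) + Q.dd i j • (Q.T i c * Q.T j d) =
      Q.κ d c • (Q.T i d * Q.T j c) + Q.dd c d • (Q.T i c * Q.T j d) := by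
  have h := FRTAlgebra.rtt Q.R i j c d
  simp only [R_eq, δ, add_smul, Finset.sum_add_distrib] at h
  simpa [mul_ite, ite_and, ite_smul, Finset.sum_ite_eq, T] using h

theorem sub_one_ne_zero : Q.r - 1 ≠ 0 := sub_ne_zero.2 Q.r_ne_one

/-- The order of the indices makes the diagonal coefficient $r-1$ on one side of the relation and
$0$ on the other. As $r\ne1$, this gives $T_i^lT_m^m$ in terms of generators whose indices are
closer together. -/
theorem T_mul_T_of_gt {i m l : Fin n} (h1 : l < m) (h2 : m < i) :
    (Q.r - 1) • (Q.T i l * Q.T m m) =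
      Q.κ m l • (Q.T i m * Q.T m l) - Q.κ i m • (Q.T m l * Q.T i m) := by
  have h := Q.rtt_T i m l m
  rw [Q.dd_of_gt h2, Q.dd_of_lt h1, zero_smul, add_zero] at h
  exact eq_sub_of_add_eq' h

theorem T_mul_T_of_lt {i m j : Fin n} (h1 : i < m) (h2 : m < j) :
    (Q.r - 1) • (Q.T m m * Q.T i j) =
      Q.κ j m • (Q.T m j * Q.T i m) - Q.κ m i • (Q.T i m * Q.T m j) := by
  have h := Q.rtt_T m i m j
  rw [Q.dd_of_gt h1, Q.dd_of_lt h2, zero_smul, add_zero] at h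
  exact eq_sub_of_add_eq' h

theorem K_mem_Bl (i : Fin n) : Q.K i ∈ Q.Bl := Algebra.subset_adjoin (Or.inl (Or.inl ⟨i, rfl⟩))

theorem Kinv_mem_Bl (i : Fin n) : Q.Kinv i ∈ Q.Bl :=
  Algebra.subset_adjoin (Or.inl (Or.inr ⟨i, rfl⟩))

theorem E_mem_Bl {i j : Fin n} (h : Adj i j) : Q.E i j ∈ Q.Bl :=
  Algebra.subset_adjoin (Or.inr ⟨i, j, h, rfl⟩)

theorem L_mem_Br (i : Fin n) : Q.L i ∈ Q.Br := Algebra.subset_adjoin (Or.inl (Or.inl ⟨i, rfl⟩))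

theorem Linv_mem_Br (i : Fin n) : Q.Linv i ∈ Q.Br :=
  Algebra.subset_adjoin (Or.inl (Or.inr ⟨i, rfl⟩))

theorem F_mem_Br {i j : Fin n} (h : Adj i j) : Q.F i j ∈ Q.Br :=
  Algebra.subset_adjoin (Or.inr ⟨i, j, h, rfl⟩)

theorem lam_T_eq_E (i j : Fin n) : Q.lam (Q.T j i) = (Q.r - 1) • Q.E i j := by
  rw [E, smul_inv_smul₀ Q.sub_one_ne_zero]

theorem rho_T_eq_F (i j : Fin n) : Q.rho (Q.T i j) =
    (Q.r ^ 2 * (Q.r - 1)⁻¹)⁻¹ • (Q.Linv j * Q.F i j * Q.Linv i) := by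
  have h : Q.r ^ 2 * (Q.r - 1)⁻¹ ≠ 0 :=
    mul_ne_zero (pow_ne_zero _ Q.r_ne_zero) (inv_ne_zero Q.sub_one_ne_zero)
  rw [F, mul_smul_comm, smul_mul_assoc, inv_smul_smul₀ h, mul_assoc (Q.L j), ← mul_assoc,
    ← mul_assoc, Linv_mul_L, one_mul, mul_assoc, L_mul_Linv, mul_one]

/-- Induction on $i-j$: distances $0$ and $1$ give $K_i$ and a multiple of a generator $E$. For
larger distances, $\lambda^+$ turns the relation for $T_i^jT_m^m$ into a formula for
$K_m\lambda^+(T_i^j)$, from which $K_m$ is cancelled. -/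
theorem lam_T_mem_Bl (i j : Fin n) : Q.lam (Q.T i j) ∈ Q.Bl := by
  suffices h : ∀ (d : ℕ) (i j : Fin n), (i : ℕ) = j + d → Q.lam (Q.T i j) ∈ Q.Bl by
    rcases lt_or_ge i j with hij | hij
    · rw [Q.lam_T_of_lt hij]
      exact zero_mem _
    · exact h (i - j) i j (by omega)
  intro d
  induction d using Nat.strong_induction_on with
  | _ d ih =>
    intro i j hd
    match d, ih, hd with
    | 0, _, hd =>
      obtain rfl : i = j := Fin.ext hd
      rw [lam_T_self]
      exact Q.K_mem_Bl i
    | 1, _, hd =>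
      rw [lam_T_eq_E]
      exact Subalgebra.smul_mem _ (Q.E_mem_Bl hd.symm) _
    | d + 2, ih, hd =>
      -- Any index strictly between $j$ and $i$ would do; this choice gives distances $d+1$ and $1$,
      -- both below $d+2$.
      let m : Fin n := ⟨j + 1, by omega⟩
      have hm : (m : ℕ) = j + 1 := rfl
      have h := congrArg Q.lam (Q.T_mul_T_of_gt (i := i) (m := m) (l := j)
        (Fin.lt_def.2 (by omega)) (Fin.lt_def.2 (by omega)))
      rw [map_smul, map_sub, map_smul, map_smul, lam_mul, lam_mul, lam_mul, lam_T_self] at h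
      have him := ih (d + 1) (by omega) i m (by omega)
      have hmj := ih 1 (by omega) m j (by omega)
      have h2 : (Q.r - 1) • (Q.K m * Q.lam (Q.T i j)) ∈ Q.Bl := by
        rw [h]
        exact sub_mem (Subalgebra.smul_mem _ (mul_mem hmj him) _)
          (Subalgebra.smul_mem _ (mul_mem him hmj) _)
      have h3 := mul_mem (Q.Kinv_mem_Bl m) (Subalgebra.smul_mem _ h2 (Q.r - 1)⁻¹)
      rwa [inv_smul_smul₀ Q.sub_one_ne_zero, ← mul_assoc, Kinv_mul_K, one_mul] at h3

/-- The mirror induction on $j-i$. Since $\rho^+$ preserves the order of products, the relation is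
needed with $T_m^m$ on the left, and $L_m^{-1}=\rho^+(T_m^m)$ is cancelled. -/
theorem rho_T_mem_Br (i j : Fin n) : Q.rho (Q.T i j) ∈ Q.Br := by
  suffices h : ∀ (d : ℕ) (i j : Fin n), (j : ℕ) = i + d → Q.rho (Q.T i j) ∈ Q.Br by
    rcases lt_or_ge j i with hij | hij
    · rw [Q.rho_T_of_gt hij]
      exact zero_mem _
    · exact h (j - i) i j (by omega)
  intro d
  induction d using Nat.strong_induction_on with
  | _ d ih =>
    intro i j hd
    match d, ih, hd with
    | 0, _, hd =>
      obtain rfl : j = i := Fin.ext hd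
      rw [rho_T_self]
      exact Q.Linv_mem_Br j
    | 1, _, hd =>
      rw [rho_T_eq_F]
      exact Subalgebra.smul_mem _ (mul_mem (mul_mem (Q.Linv_mem_Br j) (Q.F_mem_Br hd.symm))
        (Q.Linv_mem_Br i)) _
    | d + 2, ih, hd =>
      let m : Fin n := ⟨i + 1, by omega⟩
      have hm : (m : ℕ) = i + 1 := rfl
      have h := congrArg Q.rho (Q.T_mul_T_of_lt (i := i) (m := m) (j := j)
        (Fin.lt_def.2 (by omega)) (Fin.lt_def.2 (by omega)))
      rw [map_smul, map_sub, map_smul, map_smul, rho_mul, rho_mul, rho_mul, rho_T_self] at h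
      have him := ih 1 (by omega) i m (by omega)
      have hmj := ih (d + 1) (by omega) m j (by omega)
      have h2 : (Q.r - 1) • (Q.Linv m * Q.rho (Q.T i j)) ∈ Q.Br := by
        rw [h]
        exact sub_mem (Subalgebra.smul_mem _ (mul_mem hmj him) _)
          (Subalgebra.smul_mem _ (mul_mem him hmj) _)
      have h3 := mul_mem (Q.L_mem_Br m) (Subalgebra.smul_mem _ h2 (Q.r - 1)⁻¹)
      rwa [inv_smul_smul₀ Q.sub_one_ne_zero, ← mul_assoc, L_mul_Linv, one_mul] at h3

theorem lam_mem_Bl (a : Q.A) : Q.lam a ∈ Q.Bl := by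
  let S : Subalgebra k Q.A :=
    { carrier := {a | Q.lam a ∈ Q.Bl}
      mul_mem' := fun {a b} ha hb => by
        change Q.lam (a * b) ∈ Q.Bl
        rw [lam_mul]
        exact mul_mem hb ha
      add_mem' := fun {a b} ha hb => by
        change Q.lam (a + b) ∈ Q.Bl
        rw [map_add]
        exact add_mem ha hb
      algebraMap_mem' := fun c => by
        change Q.lam _ ∈ Q.Bl
        rw [Algebra.algebraMap_eq_smul_one, map_smul, lam_one]
        exact Subalgebra.smul_mem _ (one_mem _) _ }
  exact FRTAlgebra.mem_of_T S Q.lam_T_mem_Bl a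

/-- `ρ⁺` as an algebra map. -/
def rhoAlgHom : Q.A →ₐ[k] FiniteDual k Q.A := AlgHom.ofLinearMap Q.rho Q.rho_one Q.rho_mul

theorem rho_mem_Br (b : Q.A) : Q.rho b ∈ Q.Br :=
  FRTAlgebra.mem_of_T (Q.Br.comap Q.rhoAlgHom) Q.rho_T_mem_Br b

/-- The algebra `B^r` is generated by the `ρ⁺(T_i^j)` and the inverses `L_i` of the
`ρ⁺(T_i^i)`. -/
theorem Br_le_of_rho_T_mem (S : Subalgebra k (FiniteDual k Q.A))
    (h : ∀ i j, Q.rho (Q.T i j) ∈ S) (hL : ∀ i, Q.L i ∈ S) : Q.Br ≤ S := by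
  refine Algebra.adjoin_le ?_
  rintro x ((⟨i, rfl⟩ | ⟨i, rfl⟩) | ⟨i, j, -, rfl⟩)
  · exact hL i
  · rw [← rho_T_self]
    exact h i i
  · exact Subalgebra.smul_mem _ (mul_mem (mul_mem (hL j) (h i j)) (hL i)) _

end Multiparameter
end QHopf
end

noncomputable section

namespace QHopf

open scoped TensorProduct

/-! ## Translations of the finite dual -/

section Translation

variable {k : Type*} [Field k] {H : Type*} [Ring H] [Bialgebra k H]

open Coalgebra

theorem vanishesOnCofiniteIdeal_translate (y : H) (f : FiniteDual k H) :
    VanishesOnCofiniteIdeal k H (f.toDual ∘ₗ LinearMap.mulRight k y) := by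
  obtain ⟨I, _, _, g, hg⟩ := VanishesOnCofiniteIdeal.exists_factor f.2
  refine VanishesOnCofiniteIdeal.of_factor (Ideal.Quotient.mkₐ k I)
    (g ∘ₗ LinearMap.mulRight k (Ideal.Quotient.mkₐ k I y)) fun x => ?_
  refine (hg (x * y)).trans ?_
  rw [map_mul]
  rfl

/-- The translate `x ↦ f(xy)` of `f`. -/
def FiniteDual.translate (y : H) : FiniteDual k H →ₗ[k] FiniteDual k H where
  toFun f := .mk _ (vanishesOnCofiniteIdeal_translate y f)
  map_add' _ _ := rfl
  map_smul' _ _ := rfl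

@[simp] theorem FiniteDual.translate_apply (y : H) (f : FiniteDual k H) (x : H) :
    FiniteDual.translate y f x = f (x * y) := rfl

theorem FiniteDual.translate_one (f : FiniteDual k H) : FiniteDual.translate 1 f = f :=
  FiniteDual.ext fun x => by rw [translate_apply, mul_one]

theorem FiniteDual.translate_mul (y z : H) (f : FiniteDual k H) :
    FiniteDual.translate (y * z) f = FiniteDual.translate y (FiniteDual.translate z f) :=
  FiniteDual.ext fun x => by simp only [translate_apply, mul_assoc]

theorem FiniteDual.translate_add (y z : H) (f : FiniteDual k H) :
    FiniteDual.translate (y + z) f = FiniteDual.translate y f + FiniteDual.translate z f :=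
  FiniteDual.ext fun x => by
    rw [translate_apply, add_apply, translate_apply, translate_apply, mul_add, map_add]

theorem FiniteDual.translate_smul (c : k) (y : H) (f : FiniteDual k H) :
    FiniteDual.translate (c • y) f = c • FiniteDual.translate y f :=
  FiniteDual.ext fun x => by
    rw [translate_apply, smul_apply, translate_apply, mul_smul_comm, map_smul, smul_eq_mul]

theorem FiniteDual.translate_unit (y : H) :
    FiniteDual.translate y (1 : FiniteDual k H) = counit (R := k) y • 1 :=
  FiniteDual.ext fun x => by
    rw [translate_apply, smul_apply, one_apply, one_apply, Bialgebra.counit_mul, mul_comm]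

theorem FiniteDual.map_mul_tmul (f g : FiniteDual k H) (s : H ⊗[k] H) (a b : H) :
    LinearMap.mul' k k (TensorProduct.map f.toDual g.toDual (s * a ⊗ₜ[k] b)) =
      LinearMap.mul' k k (TensorProduct.map (translate a f).toDual (translate b g).toDual s) := by
  induction s with
  | zero => simp
  | add u v hu hv => simp only [add_mul, map_add, hu, hv]
  | tmul x y =>
    rw [Algebra.TensorProduct.tmul_mul_tmul]
    rfl

theorem FiniteDual.translate_mul_of_groupLike {y : H} (hy : comul (R := k) y = y ⊗ₜ[k] y)
    (f g : FiniteDual k H) : translate y (f * g) = translate y f * translate y g :=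
  FiniteDual.ext fun x => by
    rw [translate_apply, mul_apply, Bialgebra.comul_mul, hy, map_mul_tmul, mul_apply]

/-- Translation makes $H^0$ a module algebra, $y\cdot(fg)=\sum(y_1\cdot f)(y_2\cdot g)$. A
skew-primitive element thus acts as a twisted derivation, while a group-like one acts
multiplicatively. -/
theorem FiniteDual.translate_mul_of_skewPrimitive {y a b : H}
    (hy : comul (R := k) y = a ⊗ₜ[k] y + y ⊗ₜ[k] b) (f g : FiniteDual k H) :
    translate y (f * g) = translate a f * translate y g + translate y f * translate b g :=
  FiniteDual.ext fun x => by
    rw [translate_apply, mul_apply, Bialgebra.comul_mul, hy, mul_add, map_add, map_add,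
      map_mul_tmul, map_mul_tmul, add_apply, mul_apply, mul_apply]

end Translation

/-! ## Inverses on spans of eigenvectors -/

section Eigen

variable {k V : Type*} [Field k] [AddCommGroup V] [Module k V] (T : V →ₗ[k] V)

open Polynomial

/-- The vectors that are annihilated by `p(T)` for some polynomial `p` with `p(0) ≠ 0`. -/
def annihilatedAwayFromZero : Submodule k V where
  carrier := {f | ∃ p : k[X], p.coeff 0 ≠ 0 ∧ aeval T p f = 0}
  zero_mem' := ⟨1, by simp, map_zero _⟩
  add_mem' := by
    rintro f g ⟨p, hp, hpf⟩ ⟨q, hq, hqg⟩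
    -- Polynomials in $T$ commute, so $(pq)(T)$ kills both vectors.
    refine ⟨p * q, by rw [mul_coeff_zero]; exact mul_ne_zero hp hq, ?_⟩
    rw [map_add]
    nth_rewrite 1 [mul_comm]
    rw [map_mul, map_mul, Module.End.mul_apply, Module.End.mul_apply, hpf, hqg, map_zero, map_zero,
      add_zero]
  smul_mem' := by
    rintro c f ⟨p, hp, hpf⟩
    exact ⟨p, hp, by rw [map_smul, hpf, smul_zero]⟩

variable {T}

theorem mem_annihilatedAwayFromZero {μ : k} (hμ : μ ≠ 0) {f : V} (hf : T f = μ • f) :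
    f ∈ annihilatedAwayFromZero T :=
  ⟨X - C μ, by simpa using hμ, by simp [hf]⟩

/-- A relation $p(T)f=0$ with $p(0)\ne0$ expresses $T'f$ as a polynomial in $T$ applied to $f$. This
is how stability under $K_i$ passes to $K_i^{-1}$ without any finite-dimensionality of $W$. -/
theorem leftInverse_mem_of_mem {T' : V →ₗ[k] V} (hT : ∀ f, T' (T f) = f) (W : Submodule k V)
    (hW : ∀ f ∈ W, T f ∈ W) {f : V} (hf : f ∈ annihilatedAwayFromZero T) (hfW : f ∈ W) :
    T' f ∈ W := by
  obtain ⟨p, hp, h⟩ := hf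
  have hpoly : ∀ q : k[X], aeval T q f ∈ W := by
    intro q
    induction q using Polynomial.induction_on' with
    | add p q hp hq =>
      rw [map_add]
      exact add_mem hp hq
    | monomial i c =>
      rw [aeval_monomial, Module.End.mul_apply, Module.algebraMap_end_apply]
      refine W.smul_mem c ?_
      induction i with
      | zero => exact hfW
      | succ i ih =>
        rw [pow_succ', Module.End.mul_apply]
        exact hW _ ih
  -- Write $p=Xq+p(0)$; applying $T'$ to $Tq(T)f+p(0)f=0$ gives $T'f=-p(0)^{-1}q(T)f$.
  rw [← X_mul_divX_add p, map_add, LinearMap.add_apply, map_mul, aeval_X, Module.End.mul_apply,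
    aeval_C, Module.algebraMap_end_apply] at h
  have h2 := congrArg T' h
  rw [map_add, hT, map_smul, map_zero] at h2
  have h3 : T' f = -((p.coeff 0)⁻¹ • aeval T p.divX f) := by
    rw [eq_neg_iff_add_eq_zero, ← smul_right_injective V hp |>.eq_iff]
    simp only [smul_add, smul_zero, smul_inv_smul₀ hp]
    rwa [add_comm]
  rw [h3]
  exact neg_mem (W.smul_mem _ (hpoly _))

end Eigen

namespace Multiparameter

variable {k : Type*} [Field k] {n : ℕ} (Q : Multiparameter k n)

open Coalgebra WithConv

/-! ## The antipodes of `B^l` and `B^r` -/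

theorem subTensor_comul_Bl (x : Q.Bl) : subTensor k Q.Bl (comul (R := k) x) =
    comul (R := k) (x : FiniteDual k Q.A) :=
  subTensor_subComul Q.Bl Q.comul_mem_Bl x

theorem subTensor_comul_Br (x : Q.Br) : subTensor k Q.Br (comul (R := k) x) =
    comul (R := k) (x : FiniteDual k Q.A) :=
  subTensor_subComul Q.Br Q.comul_mem_Br x

theorem counit_Bl (x : Q.Bl) : counit (R := k) x = (x : FiniteDual k Q.A) 1 := rfl

/-- `K_i` as an element of `B^l`. -/
def KBl (i : Fin n) : Q.Bl := ⟨Q.K i, Q.K_mem_Bl i⟩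

/-- `K_i⁻¹` as an element of `B^l`. -/
def KinvBl (i : Fin n) : Q.Bl := ⟨Q.Kinv i, Q.Kinv_mem_Bl i⟩

/-- `E_{i+1}^i` as an element of `B^l`. -/
def EBl {i j : Fin n} (h : Adj i j) : Q.Bl := ⟨Q.E i j, Q.E_mem_Bl h⟩

/-- `L_i` as an element of `B^r`. -/
def LBr (i : Fin n) : Q.Br := ⟨Q.L i, Q.L_mem_Br i⟩

/-- `L_i⁻¹` as an element of `B^r`. -/
def LinvBr (i : Fin n) : Q.Br := ⟨Q.Linv i, Q.Linv_mem_Br i⟩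

/-- `F_i^{i+1}` as an element of `B^r`. -/
def FBr {i j : Fin n} (h : Adj i j) : Q.Br := ⟨Q.F i j, Q.F_mem_Br h⟩

theorem KBl_mul_KinvBl (i : Fin n) : Q.KBl i * Q.KinvBl i = 1 := Subtype.ext (Q.K_mul_Kinv i)

theorem KinvBl_mul_KBl (i : Fin n) : Q.KinvBl i * Q.KBl i = 1 := Subtype.ext (Q.Kinv_mul_K i)

theorem LBr_mul_LinvBr (i : Fin n) : Q.LBr i * Q.LinvBr i = 1 := Subtype.ext (Q.L_mul_Linv i)

theorem LinvBr_mul_LBr (i : Fin n) : Q.LinvBr i * Q.LBr i = 1 := Subtype.ext (Q.Linv_mul_L i)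

theorem isGroupLikeElem_KBl (i : Fin n) : IsGroupLikeElem k (Q.KBl i) where
  counit_eq_one := Q.diag_one _
  comul_eq_tmul_self := subTensor_injective Q.Bl <|
    (Q.subTensor_comul_Bl _).trans (Q.comul_diag _)

theorem isGroupLikeElem_LBr (i : Fin n) : IsGroupLikeElem k (Q.LBr i) where
  counit_eq_one := Q.diag_one _
  comul_eq_tmul_self := subTensor_injective Q.Br <|
    (Q.subTensor_comul_Br _).trans (Q.comul_diag _)

theorem KBl_mem_unitGroupLikes (i : Fin n) : Q.KBl i ∈ unitGroupLikes k Q.Bl :=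
  ⟨Q.isGroupLikeElem_KBl i, isUnit_iff_exists.2 ⟨_, Q.KBl_mul_KinvBl i, Q.KinvBl_mul_KBl i⟩⟩

theorem KinvBl_mem_unitGroupLikes (i : Fin n) : Q.KinvBl i ∈ unitGroupLikes k Q.Bl :=
  ⟨isGroupLikeElem_of_mul_eq_one (Q.isGroupLikeElem_KBl i) (Q.KBl_mul_KinvBl i)
    (Q.KinvBl_mul_KBl i), isUnit_iff_exists.2 ⟨_, Q.KinvBl_mul_KBl i, Q.KBl_mul_KinvBl i⟩⟩

theorem LBr_mem_unitGroupLikes (i : Fin n) : Q.LBr i ∈ unitGroupLikes k Q.Br :=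
  ⟨Q.isGroupLikeElem_LBr i, isUnit_iff_exists.2 ⟨_, Q.LBr_mul_LinvBr i, Q.LinvBr_mul_LBr i⟩⟩

theorem LinvBr_mem_unitGroupLikes (i : Fin n) : Q.LinvBr i ∈ unitGroupLikes k Q.Br :=
  ⟨isGroupLikeElem_of_mul_eq_one (Q.isGroupLikeElem_LBr i) (Q.LBr_mul_LinvBr i)
    (Q.LinvBr_mul_LBr i), isUnit_iff_exists.2 ⟨_, Q.LinvBr_mul_LBr i, Q.LBr_mul_LinvBr i⟩⟩

theorem comul_EBl {i j : Fin n} (h : Adj i j) : comul (R := k) (Q.EBl h) =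
    Q.KBl j ⊗ₜ[k] Q.EBl h + Q.EBl h ⊗ₜ[k] Q.KBl i :=
  subTensor_injective Q.Bl <| (Q.subTensor_comul_Bl _).trans <| by
    rw [map_add]
    exact Q.comul_E h

theorem comul_FBr {i j : Fin n} (h : Adj i j) : comul (R := k) (Q.FBr h) =
    Q.LBr i ⊗ₜ[k] Q.FBr h + Q.FBr h ⊗ₜ[k] Q.LBr j :=
  subTensor_injective Q.Br <| (Q.subTensor_comul_Br _).trans <| by
    rw [map_add]
    exact Q.comul_F h

/-- The generators of `B^l`. -/
def generatorsBl : Set Q.Bl :=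
  Set.range Q.KBl ∪ Set.range Q.KinvBl ∪ {x | ∃ i j, ∃ h : Adj i j, x = Q.EBl h}

/-- The generators of `B^r`. -/
def generatorsBr : Set Q.Br :=
  Set.range Q.LBr ∪ Set.range Q.LinvBr ∪ {x | ∃ i j, ∃ h : Adj i j, x = Q.FBr h}

theorem adjoin_generatorsBl : Algebra.adjoin k Q.generatorsBl = ⊤ := by
  rw [eq_top_iff]
  refine (Algebra.adjoin_adjoin_coe_preimage (R := k) (s := Set.range Q.K ∪ Set.range Q.Kinv ∪
    {x | ∃ i j, Adj i j ∧ x = Q.E i j})).ge.trans (Algebra.adjoin_mono ?_)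
  rintro x ((⟨i, hx⟩ | ⟨i, hx⟩) | ⟨i, j, h, hx⟩)
  · exact Or.inl (Or.inl ⟨i, Subtype.ext hx⟩)
  · exact Or.inl (Or.inr ⟨i, Subtype.ext hx⟩)
  · exact Or.inr ⟨i, j, h, Subtype.ext hx⟩

theorem adjoin_generatorsBr : Algebra.adjoin k Q.generatorsBr = ⊤ := by
  rw [eq_top_iff]
  refine (Algebra.adjoin_adjoin_coe_preimage (R := k) (s := Set.range Q.L ∪ Set.range Q.Linv ∪
    {x | ∃ i j, Adj i j ∧ x = Q.F i j})).ge.trans (Algebra.adjoin_mono ?_)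
  rintro x ((⟨i, hx⟩ | ⟨i, hx⟩) | ⟨i, j, h, hx⟩)
  · exact Or.inl (Or.inl ⟨i, Subtype.ext hx⟩)
  · exact Or.inl (Or.inr ⟨i, Subtype.ext hx⟩)
  · exact Or.inr ⟨i, j, h, Subtype.ext hx⟩

theorem generatorsBl_subset :
    Q.generatorsBl ⊆ unitGroupLikes k Q.Bl ∪ skewPrimitives k Q.Bl := by
  rintro x ((⟨i, rfl⟩ | ⟨i, rfl⟩) | ⟨i, j, h, rfl⟩)
  · exact Or.inl (Q.KBl_mem_unitGroupLikes i)
  · exact Or.inl (Q.KinvBl_mem_unitGroupLikes i)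
  · exact Or.inr ⟨_, Q.KBl_mem_unitGroupLikes j, _, Q.KBl_mem_unitGroupLikes i, Q.comul_EBl h⟩

theorem generatorsBr_subset :
    Q.generatorsBr ⊆ unitGroupLikes k Q.Br ∪ skewPrimitives k Q.Br := by
  rintro x ((⟨i, rfl⟩ | ⟨i, rfl⟩) | ⟨i, j, h, rfl⟩)
  · exact Or.inl (Q.LBr_mem_unitGroupLikes i)
  · exact Or.inl (Q.LinvBr_mem_unitGroupLikes i)
  · exact Or.inr ⟨_, Q.LBr_mem_unitGroupLikes i, _, Q.LBr_mem_unitGroupLikes j, Q.comul_FBr h⟩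

theorem exists_isAntipode_Bl : ∃ S : Q.Bl →ₗ[k] Q.Bl, IsAntipode S :=
  exists_isAntipode Q.adjoin_generatorsBl Q.generatorsBl_subset

theorem exists_isAntipode_Br : ∃ S : Q.Br →ₗ[k] Q.Br, IsAntipode S :=
  exists_isAntipode Q.adjoin_generatorsBr Q.generatorsBr_subset

theorem exists_isAntipode_cop_finiteDual_Bl :
    ∃ S : Cop (FiniteDual k Q.Bl) →ₗ[k] Cop (FiniteDual k Q.Bl), IsAntipode S := by
  obtain ⟨S, hS⟩ := exists_isAntipode_cop Q.adjoin_generatorsBl Q.generatorsBl_subset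
  exact exists_isAntipode_cop_finiteDual hS

end Multiparameter
end QHopf
end

noncomputable section

namespace QHopf

open scoped TensorProduct

namespace Multiparameter

variable {k : Type*} [Field k] {n : ℕ} (Q : Multiparameter k n)

open Coalgebra WithConv

/-! ## Evaluation on `B^l` and restriction along `λ⁺` -/

/-- The representation `f ↦ (f(T_i^j))` of `A(R_Q)⁰`. -/
def vectorRep : FiniteDual k Q.A →ₐ[k] Matrix (Fin n) (Fin n) k :=
  AlgHom.ofLinearMap
    { toFun := fun f => Matrix.of fun i j => f (Q.T i j)
      map_add' := fun _ _ => rfl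
      map_smul' := fun _ _ => rfl }
    (by
      ext i j
      exact FRTAlgebra.counit_T Q.R i j)
    (by
      intro f g
      ext i j
      exact FiniteDual.mul_apply_T f g i j)

/-- Evaluation at the elements of `A(R_Q)`, as a map to the convolution algebra of `B^l`. -/
def evConv : Q.A →ₐ[k] WithConv (Q.Bl →ₗ[k] k) :=
  AlgHom.ofLinearMap
    { toFun := fun a => toConv (FiniteDual.ev a ∘ₗ Q.Bl.val.toLinearMap)
      map_add' := fun a b =>
        WithConv.ext (LinearMap.ext fun x => map_add (x : FiniteDual k Q.A) a b)
      map_smul' := fun c a =>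
        WithConv.ext (LinearMap.ext fun x => map_smul (x : FiniteDual k Q.A) c a) }
    (WithConv.ext (LinearMap.ext fun x => rfl))
    (by
      intro a b
      refine WithConv.ext (LinearMap.ext fun x => ?_)
      have h : ∀ t : Q.Bl ⊗[k] Q.Bl, FiniteDual.ev₂ a b (subTensor k Q.Bl t) =
          LinearMap.mul' k k (TensorProduct.map (FiniteDual.ev a ∘ₗ Q.Bl.val.toLinearMap)
            (FiniteDual.ev b ∘ₗ Q.Bl.val.toLinearMap) t) := by
        intro t
        induction t with
        | zero => simp
        | add u v hu hv => simp only [map_add, hu, hv]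
        | tmul u v => rfl
      refine Eq.trans ?_ (h (comul x))
      rw [subTensor_comul_Bl, FiniteDual.ev₂_comul]
      rfl)

/-- Evaluations at the $T_i^j$ are matrix coefficients of an $n$-dimensional representation of
$B^l$, and the finite dual is closed under convolution. -/
theorem evConv_mem (a : Q.A) : Q.evConv a ∈ finiteDualSubalgebra k Q.Bl := by
  refine FRTAlgebra.mem_of_T ((finiteDualSubalgebra k Q.Bl).comap Q.evConv) (fun i j => ?_) a
  exact VanishesOnCofiniteIdeal.of_factor (Q.vectorRep.comp Q.Bl.val)
    (Matrix.entryLinearMap k k i j) fun _ => rfl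

/-- The map `A(R_Q) → (B^l)⁰` given by evaluation. -/
def evBl : Q.A →ₐ[k] FiniteDual k Q.Bl :=
  (Q.evConv.codRestrict (finiteDualSubalgebra k Q.Bl) Q.evConv_mem :)

theorem comul_evBl_T (i j : Fin n) : comul (R := k) (Q.evBl (Q.T i j)) =
    ∑ m, Q.evBl (Q.T i m) ⊗ₜ[k] Q.evBl (Q.T m j) := by
  refine FiniteDual.tensor_ext fun x y => ?_
  rw [FiniteDual.ev₂_comul, map_sum]
  exact FiniteDual.mul_apply_T (x : FiniteDual k Q.A) (y : FiniteDual k Q.A) i j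

/-- In the vector representation the $K_i^{\pm1}$ are diagonal and the generators $E$ are elementary
matrices just above the diagonal, so all of $B^l$ is upper triangular. -/
theorem apply_T_of_gt {x : FiniteDual k Q.A} (hx : x ∈ Q.Bl) {i j : Fin n} (hij : j < i) :
    x (Q.T i j) = 0 := by
  let S : Subalgebra k (FiniteDual k Q.A) :=
    { carrier := {x | ∀ i j, j < i → x (Q.T i j) = 0}
      mul_mem' := by
        intro x y hx hy i j hij
        refine (FiniteDual.mul_apply_T x y i j).trans (Finset.sum_eq_zero fun m _ => ?_)
        rcases lt_or_ge m i with h | h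
        · exact mul_eq_zero_of_left (hx i m h) _
        · exact mul_eq_zero_of_right _ (hy m j (hij.trans_le h))
      add_mem' := by
        intro x y hx hy i j hij
        rw [FiniteDual.add_apply, hx i j hij, hy i j hij, add_zero]
      algebraMap_mem' := by
        intro c i j hij
        rw [Algebra.algebraMap_eq_smul_one, FiniteDual.smul_apply, FiniteDual.one_apply]
        refine mul_eq_zero_of_right _ ((FRTAlgebra.counit_T Q.R i j).trans (if_neg hij.ne')) }
  have h : Q.Bl ≤ S := by
    refine Algebra.adjoin_le ?_
    rintro x ((⟨l, rfl⟩ | ⟨l, rfl⟩) | ⟨a, b, h, rfl⟩) i j hij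
    · exact (Q.diag_T _ i j).trans (if_neg hij.ne')
    · exact (Q.diag_T _ i j).trans (if_neg hij.ne')
    · rw [Q.E_T h.lt, if_neg]
      rintro ⟨rfl, rfl⟩
      exact hij.not_gt h.lt
  exact h hx i j hij

theorem evBl_T_of_gt {i j : Fin n} (hij : j < i) : Q.evBl (Q.T i j) = 0 :=
  FiniteDual.ext fun x => Q.apply_T_of_gt x.2 hij

/-- Triangularity kills every term of $\sum_m T_i^m\otimes T_m^i$ except $m=i$. Being group-like,
this functional becomes invertible once an antipode is available. -/
theorem isGroupLikeElem_evBl_T (i : Fin n) : IsGroupLikeElem k (Q.evBl (Q.T i i)) where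
  counit_eq_one := by
    rw [FiniteDual.counit_apply]
    exact (FRTAlgebra.counit_T Q.R i i).trans (if_pos rfl)
  comul_eq_tmul_self := by
    rw [comul_evBl_T]
    refine Finset.sum_eq_single i (fun m _ hm => ?_) (by simp)
    rcases lt_or_gt_of_ne hm with h | h
    · rw [Q.evBl_T_of_gt h, TensorProduct.zero_tmul]
    · rw [Q.evBl_T_of_gt h, TensorProduct.tmul_zero]

/-- `λ⁺` as a map to `B^l`. -/
def lamBl : Q.A →ₗ[k] Q.Bl :=
  Q.lam.codRestrict (Subalgebra.toSubmodule Q.Bl) Q.lam_mem_Bl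

theorem lamBl_one : Q.lamBl 1 = 1 := Subtype.ext Q.lam_one

theorem lamBl_mul (a b : Q.A) : Q.lamBl (a * b) = Q.lamBl b * Q.lamBl a :=
  Subtype.ext (Q.lam_mul a b)

theorem comul_lamBl (a : Q.A) : comul (R := k) (Q.lamBl a) =
    TensorProduct.map Q.lamBl Q.lamBl (comul (R := k) a) := by
  apply subTensor_injective Q.Bl
  rw [subTensor_comul_Bl]
  refine (comul_lambdaPlus Q.yangBaxter a).trans ?_
  induction comul (R := k) a with
  | zero => simp
  | add u v hu hv => simp only [map_add, hu, hv]
  | tmul u v => rfl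

/-- `λ⁺` as an algebra map to the opposite algebra of `B^l`. -/
def lamBlOp : Q.A →ₐ[k] Q.Blᵐᵒᵖ :=
  AlgHom.ofLinearMap ((MulOpposite.opLinearEquiv k).toLinearMap ∘ₗ Q.lamBl)
    (congrArg MulOpposite.op Q.lamBl_one) (fun a b => congrArg MulOpposite.op (Q.lamBl_mul a b))

/-- The restriction `f ↦ f ∘ λ⁺`, from `(B^l)⁰` to `A(R_Q)⁰`. -/
def restrictLam : FiniteDual k Q.Bl →ₐ[k] FiniteDual k Q.A :=
  AlgHom.ofLinearMap (FiniteDual.compAnti Q.lamBlOp)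
    (FiniteDual.ext fun a => by
      refine (FiniteDual.one_apply (Q.lamBl a)).trans ?_
      rw [counit_Bl]
      exact braiding_one_right Q.yangBaxter a)
    (fun f g => FiniteDual.ext fun a => by
      refine (FiniteDual.mul_apply f g (Q.lamBl a)).trans ?_
      rw [comul_lamBl, FiniteDual.mul_apply]
      induction comul (R := k) a with
      | zero => simp
      | add u v hu hv => simp only [map_add, hu, hv]
      | tmul u v => rfl)

/-- Both functionals send $a$ to $\lambda^+(a)(b)=\langle a|b\rangle_R$. Evaluation at $b$ is
therefore the required lift of $\rho^+(b)$ to $(B^l)^0$. -/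
theorem restrictLam_evBl (b : Q.A) : Q.restrictLam (Q.evBl b) = Q.rho b :=
  FiniteDual.ext fun _ => rfl

/-! ## The subalgebra of `(B^l)⁰` generated by the evaluations and by inverses -/

section Image

variable (χ : Fin n → FiniteDual k Q.Bl)

/-- The subalgebra of `(B^l)⁰` generated by the evaluations at the `T_i^j` and by the `χ i`, which
will be the inverses of the evaluations at the `T_i^i`. -/
def evSubalgebra : Subalgebra k (FiniteDual k Q.Bl) :=
  Algebra.adjoin k ((Set.range fun p : Fin n × Fin n => Q.evBl (Q.T p.1 p.2)) ∪ Set.range χ)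

theorem evBl_T_mem (i j : Fin n) : Q.evBl (Q.T i j) ∈ Q.evSubalgebra χ :=
  Algebra.subset_adjoin (Or.inl ⟨(i, j), rfl⟩)

theorem inv_mem_evSubalgebra (i : Fin n) : χ i ∈ Q.evSubalgebra χ :=
  Algebra.subset_adjoin (Or.inr ⟨i, rfl⟩)

theorem evBl_mem (a : Q.A) : Q.evBl a ∈ Q.evSubalgebra χ :=
  FRTAlgebra.mem_of_T ((Q.evSubalgebra χ).comap Q.evBl) (Q.evBl_T_mem χ) a

theorem translate_evBl_T (y : Q.Bl) (i j : Fin n) : FiniteDual.translate y (Q.evBl (Q.T i j)) =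
    ∑ m, (y : FiniteDual k Q.A) (Q.T m j) • Q.evBl (Q.T i m) := by
  refine FiniteDual.ext fun x => ?_
  rw [FiniteDual.translate_apply, FiniteDual.sum_apply]
  refine (FiniteDual.mul_apply_T (x : FiniteDual k Q.A) (y : FiniteDual k Q.A) i j).trans ?_
  exact Finset.sum_congr rfl fun m _ => mul_comm _ _

theorem translate_evBl_T_mem (y : Q.Bl) (i j : Fin n) :
    FiniteDual.translate y (Q.evBl (Q.T i j)) ∈ Q.evSubalgebra χ := by
  rw [translate_evBl_T]
  exact sum_mem fun m _ => Subalgebra.smul_mem _ (Q.evBl_T_mem χ i m) _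

theorem translate_KBl_evBl_T (l i j : Fin n) :
    FiniteDual.translate (Q.KBl l) (Q.evBl (Q.T i j)) = Q.κ l j • Q.evBl (Q.T i j) := by
  rw [translate_evBl_T, Finset.sum_eq_single j]
  · congr 1
    exact (Q.diag_T _ j j).trans (if_pos rfl)
  · intro m _ hm
    rw [show (Q.KBl l : FiniteDual k Q.A) (Q.T m j) = 0 from (Q.diag_T _ m j).trans (if_neg hm),
      zero_smul]
  · simp

theorem translate_KBl_mul (l : Fin n) (f g : FiniteDual k Q.Bl) :
    FiniteDual.translate (Q.KBl l) (f * g) =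
      FiniteDual.translate (Q.KBl l) f * FiniteDual.translate (Q.KBl l) g :=
  FiniteDual.translate_mul_of_groupLike (Q.isGroupLikeElem_KBl l).comul_eq_tmul_self f g

theorem translate_KBl_one (l : Fin n) :
    FiniteDual.translate (Q.KBl l) (1 : FiniteDual k Q.Bl) = 1 := by
  rw [FiniteDual.translate_unit, (Q.isGroupLikeElem_KBl l).counit_eq_one, one_smul]

variable {χ}

/-- Translation by $K_l$ is multiplicative and fixes $1$, so the inverse of an eigenvector is an
eigenvector for the inverse eigenvalue. -/
theorem translate_KBl_inv (h1 : ∀ i, Q.evBl (Q.T i i) * χ i = 1)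
    (h2 : ∀ i, χ i * Q.evBl (Q.T i i) = 1) (l i : Fin n) :
    FiniteDual.translate (Q.KBl l) (χ i) = (Q.κ l i)⁻¹ • χ i := by
  have h := congrArg (FiniteDual.translate (Q.KBl l)) (h1 i)
  rw [translate_KBl_mul, translate_KBl_one, translate_KBl_evBl_T, smul_mul_assoc] at h
  have h3 := congrArg (fun f => (Q.κ l i)⁻¹ • (χ i * f)) h
  simp only [mul_smul_comm, ← mul_assoc, h2, one_mul, mul_one] at h3
  rwa [inv_smul_smul₀ (Q.κ_ne_zero l i)] at h3

theorem exists_eigenvalue (h1 : ∀ i, Q.evBl (Q.T i i) * χ i = 1)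
    (h2 : ∀ i, χ i * Q.evBl (Q.T i i) = 1) (l : Fin n) {f : FiniteDual k Q.Bl}
    (hf : f ∈ Submonoid.closure ((Set.range fun p : Fin n × Fin n => Q.evBl (Q.T p.1 p.2)) ∪
      Set.range χ)) : ∃ μ : k, μ ≠ 0 ∧ FiniteDual.translate (Q.KBl l) f = μ • f := by
  induction hf using Submonoid.closure_induction with
  | one => exact ⟨1, one_ne_zero, by rw [translate_KBl_one, one_smul]⟩
  | mul f g _ _ hf hg =>
    obtain ⟨μ, hμ, hf⟩ := hf
    obtain ⟨ν, hν, hg⟩ := hg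
    exact ⟨μ * ν, mul_ne_zero hμ hν, by
      rw [translate_KBl_mul, hf, hg, smul_mul_smul_comm]⟩
  | mem f hf =>
    rcases hf with ⟨p, rfl⟩ | ⟨i, rfl⟩
    · exact ⟨_, Q.κ_ne_zero l p.2, Q.translate_KBl_evBl_T l p.1 p.2⟩
    · exact ⟨_, inv_ne_zero (Q.κ_ne_zero l i), Q.translate_KBl_inv h1 h2 l i⟩

/-- The monomials in the generators span, and each is an eigenvector with nonzero eigenvalue. -/
theorem evSubalgebra_le_annihilated (h1 : ∀ i, Q.evBl (Q.T i i) * χ i = 1)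
    (h2 : ∀ i, χ i * Q.evBl (Q.T i i) = 1) (l : Fin n) :
    Subalgebra.toSubmodule (Q.evSubalgebra χ) ≤
      annihilatedAwayFromZero (FiniteDual.translate (Q.KBl l)) := by
  rw [evSubalgebra, Algebra.adjoin_eq_span, Submodule.span_le]
  intro f hf
  obtain ⟨μ, hμ, h⟩ := Q.exists_eigenvalue h1 h2 l hf
  exact mem_annihilatedAwayFromZero hμ h

theorem translate_KBl_mem (h1 : ∀ i, Q.evBl (Q.T i i) * χ i = 1)
    (h2 : ∀ i, χ i * Q.evBl (Q.T i i) = 1) (l : Fin n) {f : FiniteDual k Q.Bl}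
    (hf : f ∈ Q.evSubalgebra χ) :
    FiniteDual.translate (Q.KBl l) f ∈ Q.evSubalgebra χ := by
  induction hf using Algebra.adjoin_induction with
  | mem f hf =>
    obtain ⟨μ, -, h⟩ := Q.exists_eigenvalue h1 h2 l (Submonoid.subset_closure hf)
    rw [h]
    exact Subalgebra.smul_mem _ (Algebra.subset_adjoin hf) _
  | algebraMap c =>
    rw [Algebra.algebraMap_eq_smul_one, map_smul, translate_KBl_one]
    exact Subalgebra.smul_mem _ (one_mem _) _
  | add f g _ _ hf hg =>
    rw [map_add]
    exact add_mem hf hg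
  | mul f g _ _ hf hg =>
    rw [translate_KBl_mul]
    exact mul_mem hf hg

/-- The twisted Leibniz rule reduces this to generators; the evaluations are clear, and the inverses
are handled by differentiating the relation that defines them. -/
theorem translate_EBl_mem (h1 : ∀ i, Q.evBl (Q.T i i) * χ i = 1)
    (h2 : ∀ i, χ i * Q.evBl (Q.T i i) = 1) {a b : Fin n} (h : Adj a b) {f : FiniteDual k Q.Bl}
    (hf : f ∈ Q.evSubalgebra χ) : FiniteDual.translate (Q.EBl h) f ∈ Q.evSubalgebra χ := by
  have hmul := FiniteDual.translate_mul_of_skewPrimitive (Q.comul_EBl h)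
  have hone : FiniteDual.translate (Q.EBl h) (1 : FiniteDual k Q.Bl) ∈ Q.evSubalgebra χ := by
    rw [FiniteDual.translate_unit]
    exact Subalgebra.smul_mem _ (one_mem _) _
  induction hf using Algebra.adjoin_induction with
  | mem f hf =>
    rcases hf with ⟨p, rfl⟩ | ⟨i, rfl⟩
    · exact Q.translate_evBl_T_mem χ _ _ _
    -- With $g$ the evaluation at $T_i^i$, applying $E$ to $g\chi_i=1$ gives
    -- $\kappa^b_i\,g(E\cdot\chi_i)=E\cdot1-(E\cdot g)(K_a\cdot\chi_i)$. Divide by $\kappa^b_i$ and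
    -- multiply on the left by $\chi_i$.
    · have h3 := hmul (Q.evBl (Q.T i i)) (χ i)
      rw [h1, translate_KBl_evBl_T, smul_mul_assoc, ← sub_eq_iff_eq_add] at h3
      have h4 : Q.evBl (Q.T i i) * FiniteDual.translate (Q.EBl h) (χ i) ∈ Q.evSubalgebra χ := by
        rw [← inv_smul_smul₀ (Q.κ_ne_zero b i)
          (Q.evBl (Q.T i i) * FiniteDual.translate (Q.EBl h) (χ i)), ← h3]
        exact Subalgebra.smul_mem _ (sub_mem hone (mul_mem (Q.translate_evBl_T_mem χ _ _ _)
          (Q.translate_KBl_mem h1 h2 a (Q.inv_mem_evSubalgebra χ i)))) _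
      have h5 := mul_mem (Q.inv_mem_evSubalgebra χ i) h4
      rwa [← mul_assoc, h2, one_mul] at h5
  | algebraMap c =>
    rw [Algebra.algebraMap_eq_smul_one, map_smul]
    exact Subalgebra.smul_mem _ hone _
  | add f g _ _ hf hg =>
    rw [map_add]
    exact add_mem hf hg
  | mul f g hf' hg' hf hg =>
    rw [hmul]
    exact add_mem (mul_mem (Q.translate_KBl_mem h1 h2 b hf') hg)
      (mul_mem hf (Q.translate_KBl_mem h1 h2 a hg'))

/-- The elements of `evSubalgebra` that vanish on the image of `λ⁺`. -/
def lamAnnihilator (χ : Fin n → FiniteDual k Q.Bl) : Submodule k (FiniteDual k Q.Bl) :=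
  Subalgebra.toSubmodule (Q.evSubalgebra χ) ⊓ LinearMap.ker Q.restrictLam.toLinearMap

theorem mem_lamAnnihilator {f : FiniteDual k Q.Bl} :
    f ∈ Q.lamAnnihilator χ ↔ f ∈ Q.evSubalgebra χ ∧ ∀ a, f (Q.lamBl a) = 0 :=
  and_congr Iff.rfl ⟨fun h a => DFunLike.congr_fun h a, fun h => FiniteDual.ext h⟩

theorem translate_lamBl_apply {f : FiniteDual k Q.Bl} (hf : ∀ a, f (Q.lamBl a) = 0) (a b : Q.A) :
    FiniteDual.translate (Q.lamBl b) f (Q.lamBl a) = 0 := by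
  rw [FiniteDual.translate_apply, ← lamBl_mul, hf]

theorem KBl_eq_lamBl (i : Fin n) : Q.KBl i = Q.lamBl (Q.T i i) :=
  Subtype.ext (Q.lam_T_self i).symm

theorem EBl_eq_lamBl {i j : Fin n} (h : Adj i j) :
    Q.EBl h = (Q.r - 1)⁻¹ • Q.lamBl (Q.T j i) := rfl

theorem translate_KBl_mem_lamAnnihilator (h1 : ∀ i, Q.evBl (Q.T i i) * χ i = 1)
    (h2 : ∀ i, χ i * Q.evBl (Q.T i i) = 1) (l : Fin n) {f : FiniteDual k Q.Bl}
    (hf : f ∈ Q.lamAnnihilator χ) : FiniteDual.translate (Q.KBl l) f ∈ Q.lamAnnihilator χ := by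
  rw [mem_lamAnnihilator] at hf ⊢
  refine ⟨Q.translate_KBl_mem h1 h2 l hf.1, fun a => ?_⟩
  rw [KBl_eq_lamBl]
  exact Q.translate_lamBl_apply hf.2 a _

/-- It suffices to treat generators $y$. The $K_l$ and $E$ lie in $\lambda^+(A)$, which is closed
under multiplication; the inverses $K_l^{-1}$ need the eigenvector argument. -/
theorem translate_mem_lamAnnihilator (h1 : ∀ i, Q.evBl (Q.T i i) * χ i = 1)
    (h2 : ∀ i, χ i * Q.evBl (Q.T i i) = 1) (y : Q.Bl) :
    ∀ f ∈ Q.lamAnnihilator χ, FiniteDual.translate y f ∈ Q.lamAnnihilator χ := by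
  have hy : y ∈ Algebra.adjoin k Q.generatorsBl := by rw [adjoin_generatorsBl]; trivial
  induction hy using Algebra.adjoin_induction with
  | mem y hy =>
    intro f hf
    rcases hy with (⟨l, rfl⟩ | ⟨l, rfl⟩) | ⟨i, j, h, rfl⟩
    · exact Q.translate_KBl_mem_lamAnnihilator h1 h2 l hf
    -- Translation by $K_l^{-1}$ is a left inverse of translation by $K_l$, which preserves the
    -- annihilator and satisfies a polynomial with nonzero constant term on $f$.
    · refine leftInverse_mem_of_mem (T := FiniteDual.translate (Q.KBl l)) (fun f => ?_) _
        (fun f hf => Q.translate_KBl_mem_lamAnnihilator h1 h2 l hf)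
        (Q.evSubalgebra_le_annihilated h1 h2 l hf.1) hf
      rw [← FiniteDual.translate_mul, KinvBl_mul_KBl, FiniteDual.translate_one]
    · rw [mem_lamAnnihilator] at hf ⊢
      refine ⟨Q.translate_EBl_mem h1 h2 h hf.1, fun a => ?_⟩
      rw [EBl_eq_lamBl, FiniteDual.translate_smul, FiniteDual.smul_apply,
        Q.translate_lamBl_apply hf.2, mul_zero]
  | algebraMap c =>
    intro f hf
    rw [Algebra.algebraMap_eq_smul_one, FiniteDual.translate_smul, FiniteDual.translate_one]
    exact Submodule.smul_mem _ c hf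
  | add y z _ _ hy hz =>
    intro f hf
    rw [FiniteDual.translate_add]
    exact add_mem (hy f hf) (hz f hf)
  | mul y z _ _ hy hz =>
    intro f hf
    rw [FiniteDual.translate_mul]
    exact hy _ (hz f hf)

/-- For every $y$ in $B^l$ the translate $y\cdot f$ still vanishes on $\lambda^+(A)$, in particular
at $1=\lambda^+(1)$, where its value is $f(y)$. -/
theorem eq_zero_of_restrictLam_eq_zero (h1 : ∀ i, Q.evBl (Q.T i i) * χ i = 1)
    (h2 : ∀ i, χ i * Q.evBl (Q.T i i) = 1) {f : FiniteDual k Q.Bl} (hf : f ∈ Q.evSubalgebra χ)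
    (h : Q.restrictLam f = 0) : f = 0 := by
  refine FiniteDual.ext fun y => ?_
  have hy := (Q.mem_lamAnnihilator.1 (Q.translate_mem_lamAnnihilator h1 h2 y f ⟨hf, h⟩)).2 1
  rw [lamBl_one, FiniteDual.translate_apply, one_mul] at hy
  exact hy

/-! ### Restriction along $\lambda^+$ as an isomorphism onto $B^r$. -/

theorem restrictLam_inv (h1 : ∀ i, Q.evBl (Q.T i i) * χ i = 1) (i : Fin n) :
    Q.restrictLam (χ i) = Q.L i := by
  have h := congrArg Q.restrictLam (h1 i)
  rw [map_mul, map_one, restrictLam_evBl, rho_T_self] at h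
  exact (left_inv_eq_right_inv (Q.L_mul_Linv i) h).symm

theorem restrictLam_mem_Br (h1 : ∀ i, Q.evBl (Q.T i i) * χ i = 1) {f : FiniteDual k Q.Bl}
    (hf : f ∈ Q.evSubalgebra χ) : Q.restrictLam f ∈ Q.Br := by
  have h : Q.evSubalgebra χ ≤ Q.Br.comap Q.restrictLam := by
    refine Algebra.adjoin_le ?_
    rintro _ (⟨p, rfl⟩ | ⟨i, rfl⟩)
    · exact Q.rho_T_mem_Br p.1 p.2
    · change Q.restrictLam (χ i) ∈ Q.Br
      rw [Q.restrictLam_inv h1]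
      exact Q.L_mem_Br i
  exact h hf

theorem exists_restrictLam_eq (h1 : ∀ i, Q.evBl (Q.T i i) * χ i = 1) {v : FiniteDual k Q.A}
    (hv : v ∈ Q.Br) : ∃ f ∈ Q.evSubalgebra χ, Q.restrictLam f = v :=
  Q.Br_le_of_rho_T_mem ((Q.evSubalgebra χ).map Q.restrictLam)
    (fun i j => ⟨_, Q.evBl_T_mem χ i j, Q.restrictLam_evBl _⟩)
    (fun i => ⟨_, Q.inv_mem_evSubalgebra χ i, Q.restrictLam_inv h1 i⟩) hv

/-- There is an algebra map `B^r → (B^l)⁰` that is a section of the restriction along `λ⁺`. -/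
theorem exists_section (h1 : ∀ i, Q.evBl (Q.T i i) * χ i = 1)
    (h2 : ∀ i, χ i * Q.evBl (Q.T i i) = 1) : ∃ θ : Q.Br →ₐ[k] FiniteDual k Q.Bl,
      (∀ v, Q.restrictLam (θ v) = v) ∧ (∀ b, θ ⟨Q.rho b, Q.rho_mem_Br b⟩ = Q.evBl b) ∧
        ∀ i, θ (Q.LBr i) = χ i := by
  let ψ : Q.evSubalgebra χ →ₐ[k] Q.Br :=
    (Q.restrictLam.comp (Q.evSubalgebra χ).val).codRestrict Q.Br
      fun f => Q.restrictLam_mem_Br h1 f.2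
  have hinj : Function.Injective ψ := by
    rw [injective_iff_map_eq_zero]
    intro f hf
    exact Subtype.ext (Q.eq_zero_of_restrictLam_eq_zero h1 h2 f.2 (congrArg Subtype.val hf))
  have hsurj : Function.Surjective ψ := fun v => by
    obtain ⟨f, hf, h⟩ := Q.exists_restrictLam_eq h1 v.2
    exact ⟨⟨f, hf⟩, Subtype.ext h⟩
  let e := AlgEquiv.ofBijective ψ ⟨hinj, hsurj⟩
  have he : ∀ (f : Q.evSubalgebra χ) (v : Q.Br), Q.restrictLam f = v → e.symm v = f :=
    fun f v h => (AlgEquiv.symm_apply_eq e).2 (Subtype.ext h.symm)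
  refine ⟨(Q.evSubalgebra χ).val.comp e.symm.toAlgHom, fun v => ?_, fun b => ?_, fun i => ?_⟩
  · exact congrArg Subtype.val (e.apply_symm_apply v)
  · exact congrArg Subtype.val (he ⟨_, Q.evBl_mem χ b⟩ _ (Q.restrictLam_evBl b))
  · exact congrArg Subtype.val (he ⟨_, Q.inv_mem_evSubalgebra χ i⟩ _ (Q.restrictLam_inv h1 i))

end Image

/-! ## The Hopf algebra map `θ` -/

theorem algHom_ext_Br {B : Type*} [Ring B] [Algebra k B] {f g : Q.Br →ₐ[k] B}
    (h : ∀ i j, f ⟨_, Q.rho_mem_Br (Q.T i j)⟩ = g ⟨_, Q.rho_mem_Br (Q.T i j)⟩)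
    (hL : ∀ i, f (Q.LBr i) = g (Q.LBr i)) : f = g := by
  refine AlgHom.ext fun v => ?_
  obtain ⟨w, hw, hwv⟩ := Q.Br_le_of_rho_T_mem ((AlgHom.equalizer f g).map Q.Br.val)
    (fun i j => ⟨_, h i j, rfl⟩) (fun i => ⟨_, hL i, rfl⟩) v.2
  obtain rfl : w = v := Subtype.ext hwv
  exact hw

theorem comul_rho_T_Br (i j : Fin n) :
    comul (R := k) (⟨_, Q.rho_mem_Br (Q.T i j)⟩ : Q.Br) =
      ∑ m, (⟨_, Q.rho_mem_Br (Q.T m j)⟩ : Q.Br) ⊗ₜ[k] ⟨_, Q.rho_mem_Br (Q.T i m)⟩ := by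
  apply subTensor_injective Q.Br
  rw [subTensor_comul_Br, map_sum]
  exact Q.comul_rho_T i j

/-- The antipode supplies the inverses $\chi_i=S_0(g_i)$ needed for the section. Compatibility with
counit and coproduct is an identity of algebra maps, so it is checked on the $\rho^+(T_i^j)$ and the
$L_i$. -/
theorem exists_bialgHom {S₀ : Cop (FiniteDual k Q.Bl) →ₗ[k] Cop (FiniteDual k Q.Bl)}
    (hS₀ : IsAntipode S₀) : ∃ θ : Q.Br →ₐc[k] Cop (FiniteDual k Q.Bl),
      Function.Injective θ ∧ ∀ b, Cop.toBase k (FiniteDual k Q.Bl) (θ ⟨Q.rho b, Q.rho_mem_Br b⟩) =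
        Q.evBl b := by
  let D := Cop (FiniteDual k Q.Bl)
  let g (i : Fin n) : D := (Cop.toBase k _).symm (Q.evBl (Q.T i i))
  have hg : ∀ i, IsGroupLikeElem k (g i) := fun i =>
    isGroupLikeElem_cop (Q.isGroupLikeElem_evBl_T i)
  have h1 : ∀ i, g i * S₀ (g i) = 1 := fun i => hS₀.groupLike_mul (hg i)
  have h2 : ∀ i, S₀ (g i) * g i = 1 := fun i => hS₀.mul_groupLike (hg i)
  obtain ⟨θ, hθ, hθρ, hθL⟩ := Q.exists_section
    (χ := fun i => Cop.toBase k (FiniteDual k Q.Bl) (S₀ (g i))) h1 h2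
  let θ' : Q.Br →ₐ[k] D := (Cop.toBase k (FiniteDual k Q.Bl)).symm.toAlgHom.comp θ
  have hρ : ∀ b, θ' ⟨Q.rho b, Q.rho_mem_Br b⟩ = (Cop.toBase k _).symm (Q.evBl b) :=
    fun b => congrArg (Cop.toBase k (FiniteDual k Q.Bl)).symm (hθρ b)
  have hL : ∀ i, θ' (Q.LBr i) = S₀ (g i) := hθL
  have hgi : ∀ i, IsGroupLikeElem k (S₀ (g i)) := fun i =>
    isGroupLikeElem_of_mul_eq_one (hg i) (h1 i) (h2 i)
  refine ⟨BialgHom.ofAlgHom θ' (Q.algHom_ext_Br (fun i j => ?_) fun i => ?_)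
    (Q.algHom_ext_Br (fun i j => ?_) fun i => ?_), fun v w h => ?_, hθρ⟩
  · rw [AlgHom.comp_apply, hρ]
    exact (braiding_one_left Q.yangBaxter (Q.T i j)).symm
  · rw [AlgHom.comp_apply, hL]
    exact (hgi i).counit_eq_one.trans (Q.isGroupLikeElem_LBr i).counit_eq_one.symm
  · rw [AlgHom.comp_apply, AlgHom.comp_apply, Bialgebra.comulAlgHom_apply,
      Bialgebra.comulAlgHom_apply, comul_rho_T_Br, hρ, map_sum]
    -- The coproduct of $\rho^+(T_i^j)$ has its legs in the opposite order to that of the evaluation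
    -- at $T_i^j$; this is why the target is the co-opposite.
    refine Eq.trans ?_ (congrArg (TensorProduct.comm k _ _) (Q.comul_evBl_T i j)).symm
    rw [map_sum]
    refine Finset.sum_congr rfl fun m _ => ?_
    rw [Algebra.TensorProduct.map_tmul, hρ, hρ]
    rfl
  · rw [AlgHom.comp_apply, AlgHom.comp_apply, Bialgebra.comulAlgHom_apply,
      Bialgebra.comulAlgHom_apply, (Q.isGroupLikeElem_LBr i).comul_eq_tmul_self, hL,
      (hgi i).comul_eq_tmul_self, Algebra.TensorProduct.map_tmul, hL]
  -- Injectivity is immediate, since restriction along $\lambda^+$ is a left inverse of $\theta$.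
  · refine Subtype.ext ?_
    rw [← hθ v, ← hθ w]
    exact congrArg Q.restrictLam h

end Multiparameter
end QHopf
end

/-! ### The lemma. -/

theorem lemma3p1 {k : Type*} [Field k] [IsAlgClosed k] [CharZero k] {n : ℕ}
    (Q : QHopf.Multiparameter k n) :
    ∃ (Sl : Q.Bl →ₗ[k] Q.Bl) (Sr : Q.Br →ₗ[k] Q.Br)
      (S₀ : QHopf.Cop (QHopf.FiniteDual k Q.Bl) →ₗ[k] QHopf.Cop (QHopf.FiniteDual k Q.Bl)),
      QHopf.IsAntipode Sl ∧ QHopf.IsAntipode Sr ∧ QHopf.IsAntipode S₀ ∧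
      ∃ (hl : ∀ a, Q.lam a ∈ Q.Bl) (hr : ∀ b, Q.rho b ∈ Q.Br)
        (θ : Q.Br →ₐc[k] QHopf.Cop (QHopf.FiniteDual k Q.Bl)),
        Function.Injective θ ∧ (∀ v, θ (Sr v) = S₀ (θ v)) ∧
        ∀ a b, (QHopf.Cop.toBase k (QHopf.FiniteDual k Q.Bl) (θ ⟨Q.rho b, hr b⟩)) ⟨Q.lam a, hl a⟩ =
          Q.form a b := by
  obtain ⟨Sl, hSl⟩ := Q.exists_isAntipode_Bl
  obtain ⟨Sr, hSr⟩ := Q.exists_isAntipode_Br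
  obtain ⟨S₀, hS₀⟩ := Q.exists_isAntipode_cop_finiteDual_Bl
  obtain ⟨θ, hθ, hθρ⟩ := Q.exists_bialgHom hS₀
  refine ⟨Sl, Sr, S₀, hSl, hSr, hS₀, Q.lam_mem_Bl, Q.rho_mem_Br, θ, hθ,
    QHopf.map_antipode hSr hS₀ θ, fun a b => ?_⟩
  rw [hθρ]
  rfl
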